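/- Let $\Sigma$ be a finite set, $Q=(q_\sigma)_{\sigma\in\Sigma}$ a probability distribution on $\Sigma$ with all $q_\sigma>0$, and let $r_1,\dots,r_k:\Sigma\to\mathbb{R}$ be linearly independent functions which are normalized: $\mathbb{E}_Q r_i=0$ and $\mathbb{E}_Q r_ir_j=\delta_{ij}$ for all $1\le i,j\le k$. For $\rho=(\rho_1,\dots,\rho_k)\in\mathbb{R}^k$ consider the probability distribution $P$ on $\Sigma$ that minimizes $D_{KL}(P\|Q)=\sum_\sigma p_\sigma\log(p_\sigma/q_\sigma)$ subject to $\mathbb{E}_P r_i=\rho_i$ for $1\le i\le k$, and the exponential parameters $\lambda_i=\lambda_i(\rho)$ defined by $$p_\sigma=q_\sigma\exp\Bigl(-1-\lambda_0-\sum_{i=1}^k\lambda_i r_i(\sigma)\Bigr)\qquad(\sigma\in\Sigma).$$ A rooted tree is a finite tree with at least one edge and with a distinguished leaf $v_{out}$. For $1\le j\le k$, a $j$-cumulant tree is a rooted tree $\Gamma$ whose edges are labeled by $r_1,\dots,r_k$, such that each vertex which is not a leaf has valency $\ge 3$ and the edge at $v_{out}$ is labeled by $r_j$. Its leaf multi-index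 is $I_\Gamma=(a_1,\dots,a_k)$, where $a_i$ is the number of leaves other than $v_{out}$ whose edge is labeled by $r_i$. Isomorphisms preserve $v_{out}$ and the labels, and $\mathrm{Aut}(\Gamma)$ is the automorphism group. The amplitude is $A_\Gamma=\prod_v C_v$, the product over all vertices $v$ that are not leaves (so $A_\Gamma=1$ for the tree with one edge), where for a vertex $v$ of valency $d$ whose edges are labeled by $r_{i_1},\dots,r_{i_d}$, $$C_v=(-1)^{d+1}\kappa(r_{i_1},\dots,r_{i_d}),$$ and $\kappa(X_1,\dots,X_d)=\partial_{t_1}\cdots\partial_{t_d}\log\mathbb{E}_Q\exp(\sum_i t_iX_i)\big|_{t=0}$ is the joint cumulant under $Q$. Then for all $\rho$ in a neighbourhood of $0$ the minimizer $P$ and the exponential parameters $\lambda_1,\dots,\lambda_k$ exist and are unique, and near $0$ they have convergent power series expansions $\lambda_j(\rho)=\sum_{I\in\mathbb{Z}_{\ge0}^k}L_{j,I}\,\rho^I$. For $1\le j\le k$ and $I\in\mathbb{Z}_{\ge 0}^k$ there are only finitely many isomorphism types of $j$-cumulant trees $\Gamma$ with $I_\Gamma=I$, and the coefficients of the expansions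 are $$L_{j,I}=(-1)^{|I|}\sum_{\Gamma}\frac{A_\Gamma}{|\mathrm{Aut}(\Gamma)|},\qquad |I|=i_1+\dots+i_k,$$ where the sum runs over representatives of all isomorphism types of $j$-cumulant trees $\Gamma$ with $I_\Gamma=I$. -/

import Mathlib

open Filter Topology

noncomputable section

/-! ### Kullback-Leibler constraint problems -/

/-- A KL constraint problem on a finite alphabet `S` with `k` constraint functions: a positive
reference distribution `q` and linearly independent functions `r 0, …, r (k-1)`. -/
structure KLConstraintProblem (S : Type*) [Fintype S] (k : ℕ) where
  q : S → ℝ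
  q_pos : ∀ s, 0 < q s
  q_sum : ∑ s, q s = 1
  r : Fin k → S → ℝ
  r_indep : LinearIndependent ℝ r

/-- The expectation of `f` with respect to the weights `p`. -/
def expect {S : Type*} [Fintype S] (p f : S → ℝ) : ℝ := ∑ s, p s * f s

/-- The joint cumulant `κ(X)` of a finite family of random variables `X i` on the finite
probability space `(S, q)`: the mixed partial derivative at `t = 0`, once in each of the
variables `t i`, of the cumulant generating function `log 𝔼 exp (∑ i, t i * X i)`.
(The enumeration of `ι` is immaterial, as mixed partial derivatives are symmetric.) -/
def jointCumulant {S : Type*} [Fintype S] (q : S → ℝ) {ι : Type*} [Fintype ι]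
    (X : ι → S → ℝ) : ℝ :=
  open Classical in
  iteratedFDeriv ℝ (Fintype.card ι)
    (fun t : ι → ℝ => Real.log (expect q (fun s => Real.exp (∑ i, t i * X i s)))) 0
    (fun m => Pi.single ((Fintype.equivFin ι).symm m) 1)

/-- The Kullback-Leibler divergence `D(p ‖ q)` (with `0 log 0 = 0`). -/
def klDivergence {S : Type*} [Fintype S] (p q : S → ℝ) : ℝ :=
  ∑ s, p s * Real.log (p s / q s)

namespace KLConstraintProblem

variable {S : Type*} [Fintype S] {k : ℕ}

/-- `𝔼 r_i = 0` and `𝔼 r_i r_j = δ_ij`. -/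
def Normalized (K : KLConstraintProblem S k) : Prop :=
  (∀ i, expect K.q (K.r i) = 0) ∧
  ∀ i j, expect K.q (fun s => K.r i s * K.r j s) = if i = j then 1 else 0

/-- The probability distributions `P` on `S` with `𝔼_P r_i = ρ_i` for all `i`. -/
def feasible (K : KLConstraintProblem S k) (ρ : Fin k → ℝ) : Set (S → ℝ) :=
  {P | (∀ s, 0 ≤ P s) ∧ ∑ s, P s = 1 ∧ ∀ i, expect P (K.r i) = ρ i}

/-- `P` minimizes the KL divergence relative to `q` subject to the constraints. -/
def IsMinimizer (K : KLConstraintProblem S k) (ρ : Fin k → ℝ) (P : S → ℝ) : Prop :=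
  P ∈ K.feasible ρ ∧ ∀ P' ∈ K.feasible ρ, klDivergence P K.q ≤ klDivergence P' K.q

/-- `lam` are exponential parameters at `ρ`: the minimizer is
`q s * exp (-1 - lam₀ - ∑ i, lam i * r i s)` for some `lam₀`. -/
def IsExponentialParameters (K : KLConstraintProblem S k) (ρ lam : Fin k → ℝ) : Prop :=
  ∃ P, K.IsMinimizer ρ P ∧
    ∃ lam₀ : ℝ, ∀ s, P s = K.q s * Real.exp (-1 - lam₀ - ∑ i, lam i * K.r i s)

/-- The exponential parameters as a function of `ρ` (an arbitrary value where there are none). -/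
def expParam (K : KLConstraintProblem S k) (ρ : Fin k → ℝ) : Fin k → ℝ :=
  Classical.epsilon (K.IsExponentialParameters ρ)

/-- The numbers `L j I` are the coefficients of the power series expansions at the origin of the
exponential parameters: `lam_j (ρ) = ∑_I L j I * ρ ^ I` for all `ρ` near `0`. -/
def IsPerturbedExpansion (K : KLConstraintProblem S k)
    (L : Fin k → (Fin k → ℕ) → ℝ) : Prop :=
  ∀ᶠ ρ in 𝓝 (0 : Fin k → ℝ), ∀ j,
    HasSum (fun I : Fin k → ℕ => L j I * ∏ i, ρ i ^ I i) (K.expParam ρ j)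

end KLConstraintProblem

/-! ### Edge-labeled rooted trees -/

/-- A finite tree with a distinguished leaf `out` and edges labeled by `Fin k`. -/
structure LabeledTree (k : ℕ) where
  n : ℕ
  graph : SimpleGraph (Fin n)
  isTree : graph.IsTree
  out : Fin n
  out_leaf : (graph.neighborSet out).ncard = 1
  label : graph.edgeSet → Fin k

namespace LabeledTree

variable {k : ℕ}

/-- The edges incident to the vertex `v`. -/
abbrev IncidentEdge (T : LabeledTree k) (v : Fin T.n) : Type :=
  {e : T.graph.edgeSet // v ∈ (e : Sym2 (Fin T.n))}

instance (T : LabeledTree k) (v : Fin T.n) : Fintype (T.IncidentEdge v) :=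
  Fintype.ofFinite _

/-- The valency of a vertex. -/
def valency (T : LabeledTree k) (v : Fin T.n) : ℕ := (T.graph.neighborSet v).ncard

/-- An isomorphism of labeled rooted trees: a graph isomorphism that preserves the distinguished
leaf and the edge labels. -/
structure Iso (T T' : LabeledTree k) where
  toIso : T.graph ≃g T'.graph
  map_out : toIso T.out = T'.out
  map_label : ∀ e, T'.label (toIso.mapEdgeSet e) = T.label e

/-- The automorphisms of a labeled rooted tree. -/
abbrev Aut (T : LabeledTree k) : Type := Iso T T

/-- Two labeled rooted trees are equivalent when they are isomorphic. -/
instance isoSetoid (k : ℕ) : Setoid (LabeledTree k) where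
  r T T' := Nonempty (Iso T T')
  iseqv :=
    { refl := fun T => ⟨⟨RelIso.refl _, rfl, fun e => by
        congr 1
        ext1
        simp [SimpleGraph.Iso.mapEdgeSet, SimpleGraph.Hom.mapEdgeSet]⟩⟩
      symm := by
        rintro T T' ⟨⟨f, h1, h2⟩⟩
        refine ⟨⟨f.symm, by rw [← h1]; exact f.symm_apply_apply _, fun e => ?_⟩⟩
        rw [← h2]
        congr 1
        exact f.mapEdgeSet.apply_symm_apply e
      trans := by
        rintro T T' T'' ⟨⟨f, h1, h2⟩⟩ ⟨⟨g, h3, h4⟩⟩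
        refine ⟨⟨f.trans g, by rw [← h3, ← h1]; rfl, fun e => ?_⟩⟩
        rw [← h2, ← h4]
        congr 1
        ext1
        simp [SimpleGraph.Iso.mapEdgeSet, SimpleGraph.Hom.mapEdgeSet, Sym2.map_map] }

/-- `T` is a `j`-cumulant tree: each vertex that is not a leaf has valency at least `3`, and the
edge at the distinguished leaf is labeled by `j`. -/
def IsCumulantTree (T : LabeledTree k) (j : Fin k) : Prop :=
  (∀ v, T.valency v ≠ 1 → 3 ≤ T.valency v) ∧
  ∀ e : T.IncidentEdge T.out, T.label e = j

/-- The leaf multi-index: entry `i` is the number of leaves, other than the distinguished one,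
whose edge is labeled by `i`. -/
def leafIndex (T : LabeledTree k) (i : Fin k) : ℕ :=
  {v | v ≠ T.out ∧ T.valency v = 1 ∧ ∃ e : T.IncidentEdge v, T.label e = i}.ncard

variable {S : Type*} [Fintype S]

/-- The coupling value of a vertex of valency `d` whose edges are labeled by `i₁, …, i_d`:
`(-1)^(d+1) κ(r_{i₁}, …, r_{i_d})`. -/
def coupling (K : KLConstraintProblem S k) (T : LabeledTree k) (v : Fin T.n) : ℝ :=
  (-1) ^ (T.valency v + 1) * jointCumulant K.q (fun e : T.IncidentEdge v => K.r (T.label e))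

/-- The amplitude: the product of the coupling values of the vertices that are not leaves. -/
def amplitude (K : KLConstraintProblem S k) (T : LabeledTree k) : ℝ :=
  open Classical in ∏ v with T.valency v ≠ 1, T.coupling K v

end LabeledTree

/-- The isomorphism types of `j`-cumulant trees with leaf multi-index `I`. -/
def cumulantTreeTypes {k : ℕ} (j : Fin k) (I : Fin k → ℕ) :
    Set (Quotient (LabeledTree.isoSetoid k)) :=
  {c | ∃ T : LabeledTree k, T.IsCumulantTree j ∧ T.leafIndex = I ∧ Quotient.mk _ T = c}

end

/-! The exponential tilt of Q by t is the unique minimizer for the constraint values given by its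
own means, because log(tilt/q) is an affine combination of the constraint functions
(`isMinimizer_iff`). Its parameters are λ = -t (`isExponentialParameters_iff`). So λ(ρ) is found by
solving ∇(cgf)(-λ) = ρ. The Taylor coefficients of ∇(cgf) at 0 are joint cumulants, and
normalization makes the constant term 0 and the linear part the identity. The equation thus becomes
the fixed-point equation λ_j = -ρ_j + ∑_{m ≥ 2} (-1)^m/m! ∑_i κ(r_j, r_{i_1}, …, r_{i_m}) λ_{i_1} ⋯
λ_{i_m} (`tiltedMean_neg_eq`).

Inserting X^m in the m-th term gives an equation in power series with a unique formal solution. The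
coefficient of X^n in that solution is 1/n! times a weighted count of labeled rooted trees with n
non-root vertices (`labeledForestSum_eq`, proved by deleting one root at a time). For small ρ a
majorant argument allows setting X = 1, and the coefficient sums then solve the numerical equation
(`SolvesTreeEquation.hasSum`). No inverse function theorem is needed: a solution is exhibited and
the minimizer is unique.

Attaching the distinguished leaf as a new root turns the count into a sum of amplitude times
monomial over n! for all trees on `Fin n` (`sum_weight`, `term_eq`). Bivalent vertices have weight
0, which leaves the cumulant trees. An isomorphism class contains n!/|Aut| trees on `Fin n`
(`card_class_mul_card_aut`), whence the factor 1/|Aut|. Grouping by leaf index gives one expansion,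
and coefficients of convergent power series are unique (`eq_zero_of_eventually_hasSum_zero`). -/

/-! ### Forests given by parent functions -/

namespace ParentForest

variable {α : Type*} [DecidableEq α]

/-- `f` is the parent function of a rooted forest with non-root vertices `A` and roots `R`. -/
def IsForest (A R : Finset α) (f : α → α) : Prop :=
  (∀ v ∉ A, f v = v) ∧ (∀ v ∈ A, f v ∈ A ∪ R) ∧ ∀ B ⊆ A, (∀ v ∈ B, f v ∈ B) → B = ∅

/-- The children of `v` among the vertices `A`. -/
def children (A : Finset α) (f : α → α) (v : α) : Finset α := A.filter (f · = v)

theorem mem_children {A : Finset α} {f : α → α} {v x : α} :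
    x ∈ children A f v ↔ x ∈ A ∧ f x = v := by simp [children]

/-- Removing a root turns its children into roots. -/
theorem IsForest.remove_root {A R : Finset α} {f : α → α} (hf : IsForest A R f) (r : α) :
    IsForest (A \ children A f r) (R.erase r ∪ children A f r)
      (fun v => if v ∈ children A f r then v else f v) := by
  obtain ⟨h1, h2, h3⟩ := hf
  refine ⟨fun v hv => ?_, fun v hv => ?_, fun B hB hc => ?_⟩
  · simp only [Finset.mem_sdiff, not_and, not_not] at hv
    beta_reduce
    split_ifs with h
    · rfl
    · exact h1 v fun hA => h (hv hA)
  · simp only [Finset.mem_sdiff] at hv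
    beta_reduce
    rw [if_neg hv.2]
    have h := h2 v hv.1
    have hr : f v ≠ r := fun e => hv.2 (mem_children.2 ⟨hv.1, e⟩)
    simp only [Finset.mem_union, Finset.mem_sdiff, Finset.mem_erase] at h ⊢
    tauto
  · refine h3 B (hB.trans Finset.sdiff_subset) fun v hv => ?_
    have := hc v hv
    beta_reduce at this
    rwa [if_neg (Finset.mem_sdiff.1 (hB hv)).2] at this

/-- A set of roots can be attached to a new root. -/
theorem IsForest.add_root {A R C : Finset α} {r : α} {f : α → α} (hd : Disjoint A R) (hr : r ∈ R)
    (hC : C ⊆ A) (hf : IsForest (A \ C) (R.erase r ∪ C) f) :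
    IsForest A R (fun v => if v ∈ C then r else f v) ∧
      children A (fun v => if v ∈ C then r else f v) r = C := by
  obtain ⟨h1, h2, h3⟩ := hf
  have hrA : r ∉ A := fun h => Finset.disjoint_left.1 hd h hr
  refine ⟨⟨fun v hv => ?_, fun v hv => ?_, fun B hB hc => ?_⟩, ?_⟩
  · have : v ∉ C := fun h => hv (hC h)
    beta_reduce
    rw [if_neg this]
    exact h1 v fun h => hv (Finset.mem_sdiff.1 h).1
  · dsimp only
    split_ifs with h
    · exact Finset.mem_union_right _ hr
    · have := h2 v (Finset.mem_sdiff.2 ⟨hv, h⟩)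
      simp only [Finset.mem_union, Finset.mem_sdiff, Finset.mem_erase] at this ⊢
      have := @hC (f v)
      tauto
  · have hBC : ∀ v ∈ B, v ∉ C := fun v hv h => by
      have := hc v hv
      beta_reduce at this
      rw [if_pos h] at this
      exact hrA (hB this)
    refine h3 B (fun v hv => Finset.mem_sdiff.2 ⟨hB hv, hBC v hv⟩) fun v hv => ?_
    have := hc v hv
    beta_reduce at this
    rwa [if_neg (hBC v hv)] at this
  · ext v
    rw [mem_children]
    constructor
    · rintro ⟨hv, h⟩
      by_contra hvC
      rw [if_neg hvC] at h
      have := h2 v (Finset.mem_sdiff.2 ⟨hv, hvC⟩)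
      rw [h] at this
      simp only [Finset.mem_union, Finset.mem_sdiff, Finset.mem_erase] at this
      have := @hC r
      tauto
    · intro h
      exact ⟨hC h, if_pos h⟩

variable [Fintype α]

open Classical in
/-- The sum over all forests of the products of the vertex weights. -/
noncomputable def forestSum (w : α → Finset α → ℝ) (A R : Finset α) : ℝ :=
  ∑ f : α → α with IsForest A R f, ∏ v ∈ A ∪ R, w v (children A f v)

theorem forestSum_empty (w : α → Finset α → ℝ) : forestSum w ∅ ∅ = 1 := by
  classical
  unfold forestSum
  have : (Finset.univ.filter fun f : α → α => IsForest ∅ ∅ f) = {id} := by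
    ext f
    simp only [Finset.mem_filter, Finset.mem_univ, true_and, Finset.mem_singleton]
    constructor
    · intro h
      funext v
      exact h.1 v (by simp)
    · rintro rfl
      exact ⟨fun _ _ => rfl, by simp, fun B hB _ => Finset.subset_empty.1 hB⟩
  rw [this]
  simp

/-- Without roots the set `A` would itself be closed under the parent function, against acyclicity.
-/
theorem forestSum_no_root (w : α → Finset α → ℝ) {A : Finset α} (hA : A.Nonempty) :
    forestSum w A ∅ = 0 := by
  classical
  unfold forestSum
  refine Finset.sum_eq_zero fun f hf => ?_
  obtain ⟨-, h2, h3⟩ := (Finset.mem_filter.1 hf).2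
  exact absurd (h3 A subset_rfl (by simpa using h2)) hA.ne_empty

/-- Forests are sorted by the set `C` of children of `r`. Deleting `r` promotes `C` to roots, and
reattaching `C` to `r` is the inverse; the children of all other vertices do not change. -/
theorem forestSum_step (w : α → Finset α → ℝ) {A R : Finset α} (hd : Disjoint A R) {r : α}
    (hr : r ∈ R) :
    forestSum w A R =
      ∑ C ∈ A.powerset, w r C * forestSum w (A \ C) (R.erase r ∪ C) := by
  classical
  have hrA : r ∉ A := fun h => Finset.disjoint_left.1 hd h hr
  conv_lhs => unfold forestSum
  rw [← Finset.sum_fiberwise_of_maps_to (t := A.powerset) (g := fun f => children A f r)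
    (fun f _ => Finset.mem_powerset.2 (Finset.filter_subset _ _))]
  refine Finset.sum_congr rfl fun C hC => ?_
  rw [Finset.mem_powerset] at hC
  unfold forestSum
  rw [Finset.mul_sum]
  refine Finset.sum_bij' (fun f _ v => if v ∈ C then v else f v)
    (fun f _ v => if v ∈ C then r else f v) ?_ ?_ ?_ ?_ ?_
  · intro f hf
    simp only [Finset.mem_filter, Finset.mem_univ, true_and] at hf ⊢
    have := hf.1.remove_root r
    rwa [hf.2] at this
  · intro f hf
    simp only [Finset.mem_filter, Finset.mem_univ, true_and] at hf ⊢
    exact hf.add_root hd hr hC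
  · intro f hf
    simp only [Finset.mem_filter, Finset.mem_univ, true_and] at hf
    funext v
    by_cases h : v ∈ C
    · have hv := h
      rw [← hf.2, mem_children] at hv
      simp [h, hv.2]
    · simp [h]
  · intro f hf
    simp only [Finset.mem_filter, Finset.mem_univ, true_and] at hf
    funext v
    by_cases h : v ∈ C
    · simp [h, hf.1 v]
    · simp [h]
  · intro f hf
    simp only [Finset.mem_filter, Finset.mem_univ, true_and] at hf
    have hset : A ∪ R = insert r ((A \ C) ∪ (R.erase r ∪ C)) := by
      ext v
      have := @hC v
      by_cases hv : v = r
      · subst hv; simp [hr]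
      · simp only [Finset.mem_union, Finset.mem_insert, Finset.mem_sdiff, Finset.mem_erase, hv]
        tauto
    have hrn : r ∉ (A \ C) ∪ (R.erase r ∪ C) := by
      have := @hC r
      simp only [Finset.mem_union, Finset.mem_sdiff, Finset.mem_erase]
      tauto
    rw [hset, Finset.prod_insert hrn, hf.2]
    congr 1
    refine Finset.prod_congr rfl fun v hv => ?_
    congr 1
    have hvr : v ≠ r := fun e => hrn (e ▸ hv)
    ext x
    simp only [mem_children, Finset.mem_sdiff]
    by_cases hx : x ∈ C
    · have hx' := hx
      rw [← hf.2, mem_children] at hx'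
      simp [hx, hx'.2, hvr.symm]
    · simp [hx]

/-! ### Labeled forests and coefficients of power series -/

variable {k : ℕ}

open Classical in
/-- The sum over all labelings (prescribed outside `A`) and all forests of the product of the
vertex weights `c v (label) (labels of the children)`. -/
noncomputable def labeledForestSum (c : α → Fin k → Multiset (Fin k) → ℝ) (A R : Finset α)
    (l₀ : α → Fin k) : ℝ :=
  ∑ l : α → Fin k with ∀ v ∉ A, l v = l₀ v,
    forestSum (fun v C => c v (l v) (C.val.map l)) A R

/-- The weight of `r` sees only the labels on `C`, so a labeling is chosen first on `C` and then on
`A \ C`. -/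
theorem labeledForestSum_step (c : α → Fin k → Multiset (Fin k) → ℝ) {A R : Finset α}
    (hd : Disjoint A R) {r : α} (hr : r ∈ R) (l₀ : α → Fin k) :
    labeledForestSum c A R l₀ =
      open Classical in
      ∑ C ∈ A.powerset, ∑ l : α → Fin k with ∀ v ∉ C, l v = l₀ v,
        c r (l₀ r) (C.val.map l) * labeledForestSum c (A \ C) (R.erase r ∪ C) l := by
  classical
  have hrA : r ∉ A := fun h => Finset.disjoint_left.1 hd h hr
  unfold labeledForestSum
  simp_rw [forestSum_step _ hd hr]
  rw [Finset.sum_comm]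
  refine Finset.sum_congr rfl fun C hC => ?_
  rw [Finset.mem_powerset] at hC
  rw [← Finset.sum_fiberwise_of_maps_to
    (t := Finset.univ.filter fun l : α → Fin k => ∀ v ∉ C, l v = l₀ v)
    (g := fun l v => if v ∈ C then l v else l₀ v)
    (fun l _ => by simp +contextual)]
  refine Finset.sum_congr rfl fun l₁ hl₁ => ?_
  simp only [Finset.mem_filter, Finset.mem_univ, true_and] at hl₁
  rw [Finset.mul_sum]
  refine Finset.sum_congr ?_ fun l hl => ?_
  · ext l
    simp only [Finset.mem_filter, Finset.mem_univ, true_and, Finset.mem_sdiff, not_and, not_not]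
    constructor
    · rintro ⟨h1, h2⟩ v hv
      rw [← h2]
      by_cases h : v ∈ C
      · simp [h]
      · simp [h, h1 v fun hA => h (hv hA)]
    · intro h
      refine ⟨fun v hv => ?_, ?_⟩
      · rw [h v fun h' => absurd h' hv, hl₁ v fun h' => hv (hC h')]
      · funext v
        by_cases hv : v ∈ C
        · simp [hv, h v]
        · simp [hv, hl₁ v hv]
  · simp only [Finset.mem_filter, Finset.mem_univ, true_and, Finset.mem_sdiff, not_and,
      not_not] at hl
    have e1 : l r = l₀ r := by
      rw [hl r fun h => absurd h hrA, hl₁ r fun h => hrA (hC h)]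
    have e2 : C.val.map l = C.val.map l₁ :=
      Multiset.map_congr rfl fun v hv => hl v fun _ => hv
    rw [e1, e2]

/-- Shows that the contribution of a child set depends only on its size, so that sums over subsets
can be collected by cardinality. -/
theorem sum_labelings_eq (C : Finset α) (l₀ : α → Fin k) (φ : Multiset (Fin k) → ℝ) :
    open Classical in
    ∑ l : α → Fin k with ∀ v ∉ C, l v = l₀ v, φ (C.val.map l) =
      ∑ i : Fin C.card → Fin k, φ (Finset.univ.val.map i) := by
  classical
  let e := C.equivFin
  symm
  refine Finset.sum_bij' (fun i _ v => if h : v ∈ C then i (e ⟨v, h⟩) else l₀ v)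
    (fun l _ a => l (e.symm a)) ?_ (fun _ _ => Finset.mem_univ _) ?_ ?_ ?_
  · intro i _
    simp +contextual
  · intro i _
    funext a
    simp
  · intro l hl
    simp only [Finset.mem_filter, Finset.mem_univ, true_and] at hl
    funext v
    by_cases h : v ∈ C
    · simp [h]
    · simp [h, hl v h]
  · intro i _
    congr 1
    have h1 : C.val = Finset.univ.val.map (fun a : Fin C.card => (e.symm a : α)) := by
      have : C = Finset.univ.map (e.symm.toEmbedding.trans (Function.Embedding.subtype _)) := by
        ext v
        simp only [Finset.mem_map, Finset.mem_univ, true_and]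
        constructor
        · intro h
          exact ⟨e ⟨v, h⟩, by simp⟩
        · rintro ⟨a, rfl⟩
          exact (e.symm a).2
      conv_lhs => rw [this]
      rfl
    conv_rhs => rw [h1]
    rw [Multiset.map_map]
    refine Multiset.map_congr rfl fun a _ => ?_
    simp

/-- The power series equation `P j = ∑ m, X ^ m / m! * ∑ i, c j i * ∏ a, P (i a)`. -/
def SolvesTreeEquation (c : Fin k → Multiset (Fin k) → ℝ) (P : Fin k → PowerSeries ℝ) : Prop :=
  ∀ j n N, n ≤ N → (P j).coeff n = ∑ m ∈ Finset.range (N + 1), PowerSeries.coeff n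
    (PowerSeries.X ^ m * (PowerSeries.C (1 / (m.factorial : ℝ)) *
      ∑ i : Fin m → Fin k, PowerSeries.C (c j (Finset.univ.val.map i)) * ∏ a, P (i a)))

theorem SolvesTreeEquation.coeff_mul {c : Fin k → Multiset (Fin k) → ℝ}
    {P : Fin k → PowerSeries ℝ} (hP : SolvesTreeEquation c P) (j : Fin k) (Q : PowerSeries ℝ)
    (n : ℕ) :
    (P j * Q).coeff n = ∑ m ∈ Finset.range (n + 1), 1 / (m.factorial : ℝ) *
      ∑ i : Fin m → Fin k, c j (Finset.univ.val.map i) *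
        PowerSeries.coeff (n - m) ((∏ a, P (i a)) * Q) := by
  have h1 : (P j * Q).coeff n = PowerSeries.coeff n ((∑ m ∈ Finset.range (n + 1),
    (PowerSeries.X ^ m * (PowerSeries.C (1 / (m.factorial : ℝ)) *
      ∑ i : Fin m → Fin k, PowerSeries.C (c j (Finset.univ.val.map i)) * ∏ a, P (i a)))) * Q) := by
    rw [PowerSeries.coeff_mul, PowerSeries.coeff_mul]
    refine Finset.sum_congr rfl fun p hp => ?_
    rw [hP j p.1 n (Finset.HasAntidiagonal.antidiagonal.fst_le hp), map_sum]
  rw [h1, Finset.sum_mul, map_sum]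
  refine Finset.sum_congr rfl fun m hm => ?_
  rw [mul_assoc, PowerSeries.coeff_X_pow_mul', if_pos (Finset.mem_range_succ_iff.1 hm), mul_assoc,
    PowerSeries.coeff_C_mul, Finset.sum_mul, map_sum]
  simp_rw [mul_assoc, PowerSeries.coeff_C_mul]

/-- Deleting a root `r` corresponds to expanding the factor `P (l₀ r)` by the tree equation: m
children give m new factors and use up m of the remaining vertices, which is what X^m records. The
weights need to agree with `c` only on the vertices involved, so that one exceptional root can be
treated separately later. -/
theorem labeledForestSum_eq {c : Fin k → Multiset (Fin k) → ℝ}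
    {P : Fin k → PowerSeries ℝ} (hP : SolvesTreeEquation c P)
    {c' : α → Fin k → Multiset (Fin k) → ℝ} (A R : Finset α)
    (hd : Disjoint A R) (hc : ∀ v ∈ A ∪ R, c' v = c) (l₀ : α → Fin k) :
    labeledForestSum c' A R l₀ =
      A.card.factorial * PowerSeries.coeff A.card (∏ r ∈ R, P (l₀ r)) := by
  classical
  induction hN : A.card + R.card using Nat.strong_induction_on generalizing A R l₀ with
  | _ N ih =>
    subst hN
    rcases R.eq_empty_or_nonempty with rfl | ⟨r, hr⟩
    · rcases A.eq_empty_or_nonempty with rfl | hA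
      · have : (Finset.univ.filter fun l : α → Fin k => ∀ v ∉ (∅ : Finset α), l v = l₀ v)
            = {l₀} := by
          ext l
          simp [funext_iff]
        unfold labeledForestSum
        rw [this]
        simp [forestSum_empty]
      · unfold labeledForestSum
        simp [forestSum_no_root _ hA, PowerSeries.coeff_one, hA.ne_empty]
    · rw [labeledForestSum_step c' hd hr, hc r (Finset.mem_union_right _ hr)]
      have key : ∀ C ∈ A.powerset, (∑ l : α → Fin k with ∀ v ∉ C, l v = l₀ v,
          c (l₀ r) (C.val.map l) * labeledForestSum c' (A \ C) (R.erase r ∪ C) l) =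
          (fun m => ((A.card - m).factorial : ℝ) * ∑ i : Fin m → Fin k,
            c (l₀ r) (Finset.univ.val.map i) * PowerSeries.coeff (A.card - m)
              ((∏ a, P (i a)) * ∏ s ∈ R.erase r, P (l₀ s))) C.card := by
        intro C hC
        rw [Finset.mem_powerset] at hC
        have hCR : Disjoint (R.erase r) C :=
          ((hd.mono_left hC).symm).mono_left (Finset.erase_subset _ _)
        have hcard : (A \ C).card = A.card - C.card := Finset.card_sdiff_of_subset hC
        have hle := Finset.card_le_card hC
        have hpos := Finset.card_pos.2 ⟨r, hr⟩
        have hdis : Disjoint (A \ C) (R.erase r ∪ C) :=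
          Finset.disjoint_union_right.2
            ⟨hd.mono Finset.sdiff_subset (Finset.erase_subset _ _), Finset.sdiff_disjoint⟩
        have hc' : ∀ v ∈ A \ C ∪ (R.erase r ∪ C), c' v = c := fun v hv => hc v <| by
          have := @hC v
          simp only [Finset.mem_union, Finset.mem_sdiff, Finset.mem_erase] at hv ⊢
          tauto
        have hlt : (A \ C).card + (R.erase r ∪ C).card < A.card + R.card := by
          rw [hcard, Finset.card_union_of_disjoint hCR, Finset.card_erase_of_mem hr]
          omega
        have := sum_labelings_eq C l₀ fun s => c (l₀ r) s * (((A.card - C.card).factorial : ℝ) *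
          PowerSeries.coeff (A.card - C.card) ((s.map P).prod * ∏ s ∈ R.erase r, P (l₀ s)))
        dsimp only
        rw [Finset.mul_sum]
        trans
        swap
        · refine this.trans (Finset.sum_congr rfl fun i _ => ?_)
          rw [Multiset.map_map, mul_left_comm]
          rfl
        · refine Finset.sum_congr rfl fun l hl => ?_
          simp only [Finset.mem_filter, Finset.mem_univ, true_and] at hl
          rw [ih _ hlt _ _ hdis hc' _ rfl, hcard, Finset.prod_union hCR, Multiset.map_map, mul_comm
            (∏ s ∈ R.erase r, _)]
          congr 4
          refine Finset.prod_congr rfl fun s hs => ?_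
          rw [hl s fun h => Finset.disjoint_left.1 hCR hs h]
      refine (Finset.sum_congr rfl key).trans ((Finset.sum_powerset_apply_card (fun m =>
        ((A.card - m).factorial : ℝ) * ∑ i : Fin m → Fin k,
            c (l₀ r) (Finset.univ.val.map i) * PowerSeries.coeff (A.card - m)
              ((∏ a, P (i a)) * ∏ s ∈ R.erase r, P (l₀ s)))).trans ?_)
      rw [← Finset.mul_prod_erase _ _ hr, hP.coeff_mul, Finset.mul_sum]
      refine Finset.sum_congr rfl fun m hm => ?_
      have hm' := Finset.mem_range_succ_iff.1 hm
      rw [nsmul_eq_mul, ← mul_assoc, ← mul_assoc]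
      congr 1
      -- The choice of the m children together with the inductive factor (|A| - m)! produces
      -- |A|!/m!, which accounts for the 1/m! of the tree equation.
      have := Nat.choose_mul_factorial_mul_factorial hm'
      have hm0 : (m.factorial : ℝ) ≠ 0 := by positivity
      field_simp
      exact_mod_cast (by rw [← this]; ring)

end ParentForest

/-! ### Formal solution of the tree equation and its convergence at X = 1 -/

namespace ParentForest

variable {k : ℕ}

/-- The `m`-th term of the tree equation, without the factor `X ^ m`. -/
noncomputable def treeTerm (c : Fin k → Multiset (Fin k) → ℝ) (P : Fin k → PowerSeries ℝ) (m : ℕ)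
    (j : Fin k) : PowerSeries ℝ :=
  PowerSeries.C (1 / (m.factorial : ℝ)) *
    ∑ i : Fin m → Fin k, PowerSeries.C (c j (Finset.univ.val.map i)) * ∏ a, P (i a)

theorem X_pow_dvd_treeTerm_sub (c : Fin k → Multiset (Fin k) → ℝ) {P Q : Fin k → PowerSeries ℝ}
    {N : ℕ} (h : ∀ a, PowerSeries.X ^ N ∣ P a - Q a) (m : ℕ) (j : Fin k) :
    PowerSeries.X ^ N ∣ treeTerm c P m j - treeTerm c Q m j := by
  have h' : ∀ a, Ideal.Quotient.mk (Ideal.span {(PowerSeries.X : PowerSeries ℝ) ^ N}) (P a) =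
      Ideal.Quotient.mk _ (Q a) := fun a => by
    rw [Ideal.Quotient.eq, Ideal.mem_span_singleton]; exact h a
  rw [← Ideal.mem_span_singleton, ← Ideal.Quotient.eq]
  simp only [treeTerm, map_mul, map_sum, map_prod, h']

/-- The right-hand side of the tree equation is an X-adic contraction: the term m = 0 does not
depend on the series, and every other term carries a factor X. -/
theorem X_pow_succ_dvd_treeTerm_sub (c : Fin k → Multiset (Fin k) → ℝ)
    {P Q : Fin k → PowerSeries ℝ} {N : ℕ} (h : ∀ a, PowerSeries.X ^ N ∣ P a - Q a) (m : ℕ)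
    (j : Fin k) :
    PowerSeries.X ^ (N + 1) ∣
      PowerSeries.X ^ m * treeTerm c P m j - PowerSeries.X ^ m * treeTerm c Q m j := by
  rcases m with _ | m
  · simp [treeTerm]
  · rw [← mul_sub, add_comm N 1, pow_add]
    refine mul_dvd_mul ?_ (X_pow_dvd_treeTerm_sub c h _ _)
    exact pow_dvd_pow _ (by omega)

/-- The iterates converging to the solution of the tree equation. -/
noncomputable def treeIter (c : Fin k → Multiset (Fin k) → ℝ) : ℕ → Fin k → PowerSeries ℝ
  | 0 => fun _ => 0
  | N + 1 => fun j => ∑ m ∈ Finset.range (N + 1), PowerSeries.X ^ m * treeTerm c (treeIter c N) m j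

theorem X_pow_dvd_treeIter_succ_sub (c : Fin k → Multiset (Fin k) → ℝ) (N : ℕ) (j : Fin k) :
    PowerSeries.X ^ N ∣ treeIter c (N + 1) j - treeIter c N j := by
  induction N generalizing j with
  | zero => simp
  | succ N ih =>
    change _ ∣ ∑ m ∈ Finset.range (N + 1 + 1),
        PowerSeries.X ^ m * treeTerm c (treeIter c (N + 1)) m j -
      ∑ m ∈ Finset.range (N + 1), PowerSeries.X ^ m * treeTerm c (treeIter c N) m j
    rw [Finset.sum_range_succ, add_sub_right_comm, ← Finset.sum_sub_distrib]
    exact dvd_add (Finset.dvd_sum fun m _ => X_pow_succ_dvd_treeTerm_sub c ih m j)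
      (dvd_mul_right _ _)

theorem coeff_treeIter (c : Fin k → Multiset (Fin k) → ℝ) {n N : ℕ} (h : n < N) (j : Fin k) :
    PowerSeries.coeff n (treeIter c N j) = PowerSeries.coeff n (treeIter c (n + 1) j) := by
  induction N, h using Nat.le_induction with
  | base => rfl
  | succ N hN ih =>
    rw [← ih, ← sub_eq_zero, ← map_sub]
    exact PowerSeries.X_pow_dvd_iff.1 (X_pow_dvd_treeIter_succ_sub c N j) n hN

theorem exists_solvesTreeEquation (c : Fin k → Multiset (Fin k) → ℝ) :
    ∃ P, SolvesTreeEquation c P := by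
  refine ⟨fun j => PowerSeries.mk fun n => PowerSeries.coeff n (treeIter c (n + 1) j), ?_⟩
  intro j n N hn
  set P : Fin k → PowerSeries ℝ :=
    fun j => PowerSeries.mk fun n => PowerSeries.coeff n (treeIter c (n + 1) j) with hP
  have h1 : ∀ a, PowerSeries.X ^ N ∣ P a - treeIter c N a := fun a => by
    refine PowerSeries.X_pow_dvd_iff.2 fun m hm => ?_
    rw [map_sub, hP, PowerSeries.coeff_mk, coeff_treeIter c hm, sub_self]
  have h2 : (P j).coeff n = PowerSeries.coeff n (treeIter c (N + 1) j) := by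
    rw [hP, PowerSeries.coeff_mk, coeff_treeIter c (Nat.lt_succ_of_le hn)]
  change (P j).coeff n = ∑ m ∈ Finset.range (N + 1),
    PowerSeries.coeff n (PowerSeries.X ^ m * treeTerm c P m j)
  rw [h2, treeIter, map_sum]
  refine Finset.sum_congr rfl fun m _ => ?_
  symm
  rw [← sub_eq_zero, ← map_sub]
  exact PowerSeries.X_pow_dvd_iff.1 (X_pow_succ_dvd_treeTerm_sub c h1 m j) n
    (Nat.lt_succ_of_le hn)

theorem SolvesTreeEquation.coeff_eq {c : Fin k → Multiset (Fin k) → ℝ}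
    {P : Fin k → PowerSeries ℝ} (hP : SolvesTreeEquation c P) (j : Fin k) (n : ℕ) :
    (P j).coeff n = labeledForestSum (fun _ => c) (Finset.univ.erase (0 : Fin (n + 1))) {0}
      (fun _ => j) /
      n.factorial := by
  rw [labeledForestSum_eq hP _ _ (by simp) fun _ _ => rfl]
  have : (n.factorial : ℝ) ≠ 0 := by positivity
  simp only [Finset.mem_univ, Finset.card_erase_of_mem, Finset.card_univ, Fintype.card_fin,
    add_tsub_cancel_right, Finset.prod_singleton]
  field_simp

/-- Both coefficients are the same forest sum up to absolute values of the weights, so this is the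
triangle inequality. -/
theorem SolvesTreeEquation.abs_coeff_le {c : Fin k → Multiset (Fin k) → ℝ}
    {P Q : Fin k → PowerSeries ℝ} (hP : SolvesTreeEquation c P)
    (hQ : SolvesTreeEquation (fun j s => |c j s|) Q) (j : Fin k) (n : ℕ) :
    |(P j).coeff n| ≤ (Q j).coeff n := by
  rw [hP.coeff_eq, hQ.coeff_eq, abs_div, Nat.abs_cast]
  gcongr
  unfold labeledForestSum forestSum
  refine (Finset.abs_sum_le_sum_abs _ _).trans (Finset.sum_le_sum fun l _ => ?_)
  refine (Finset.abs_sum_le_sum_abs _ _).trans (Finset.sum_le_sum fun f _ => ?_)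
  rw [Finset.abs_prod]

/-- The partial sums of the coefficients. -/
noncomputable def partialSum (N : ℕ) (f : PowerSeries ℝ) : ℝ :=
  ∑ n ∈ Finset.range N, f.coeff n

theorem coeff_prod_nonneg {ι : Type*} (s : Finset ι) {f : ι → PowerSeries ℝ}
    (hf : ∀ i n, 0 ≤ (f i).coeff n) (n : ℕ) : 0 ≤ (∏ i ∈ s, f i).coeff n := by
  classical
  induction s using Finset.induction_on generalizing n with
  | empty => rw [Finset.prod_empty, PowerSeries.coeff_one]; split_ifs <;> simp
  | insert a s ha ih =>
    rw [Finset.prod_insert ha, PowerSeries.coeff_mul]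
    exact Finset.sum_nonneg fun p _ => mul_nonneg (hf _ _) (ih _)

theorem partialSum_nonneg (N : ℕ) {f : PowerSeries ℝ} (hf : ∀ n, 0 ≤ f.coeff n) :
    0 ≤ partialSum N f := Finset.sum_nonneg fun n _ => hf n

theorem sum_le_sum_of_injOn {ι κ : Type*} {s : Finset ι} {t : Finset κ} (e : ι → κ)
    {f : ι → ℝ} {g : κ → ℝ} (he : ∀ x ∈ s, e x ∈ t) (hi : Set.InjOn e s)
    (hfg : ∀ x ∈ s, f x = g (e x)) (hg : ∀ y, 0 ≤ g y) : ∑ x ∈ s, f x ≤ ∑ y ∈ t, g y := by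
  classical
  rw [Finset.sum_congr rfl hfg, ← Finset.sum_image hi]
  exact Finset.sum_le_sum_of_subset_of_nonneg (Finset.image_subset_iff.2 he) fun y _ _ => hg y

theorem partialSum_mul_le (N : ℕ) {f g : PowerSeries ℝ} (hf : ∀ n, 0 ≤ f.coeff n)
    (hg : ∀ n, 0 ≤ g.coeff n) :
    partialSum N (f * g) ≤ partialSum N f * partialSum N g := by
  unfold partialSum
  simp_rw [PowerSeries.coeff_mul]
  rw [Finset.sum_mul_sum, ← Finset.sum_product', Finset.sum_sigma']
  refine sum_le_sum_of_injOn (fun p => p.2) ?_ ?_ (fun _ _ => rfl)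
    fun p => mul_nonneg (hf _) (hg _)
  · rintro ⟨n, a, b⟩ h
    simp only [Finset.mem_sigma, Finset.mem_range, Finset.HasAntidiagonal.mem_antidiagonal,
      Finset.mem_product] at h ⊢
    omega
  · rintro ⟨n, a, b⟩ h ⟨n', a', b'⟩ h' e
    simp only [Finset.mem_coe, Finset.mem_sigma, Finset.HasAntidiagonal.mem_antidiagonal,
      Prod.mk.injEq] at h h' e
    obtain ⟨rfl, rfl⟩ := e
    obtain rfl := h.2.symm.trans h'.2
    rfl

theorem partialSum_prod_le {ι : Type*} (s : Finset ι) (N : ℕ) {f : ι → PowerSeries ℝ}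
    (hf : ∀ i n, 0 ≤ (f i).coeff n) :
    partialSum N (∏ i ∈ s, f i) ≤ ∏ i ∈ s, partialSum N (f i) := by
  classical
  induction s using Finset.induction_on with
  | empty =>
    simp only [Finset.prod_empty, partialSum, PowerSeries.coeff_one, Finset.sum_ite_eq']
    split_ifs <;> simp
  | insert a s ha ih =>
    rw [Finset.prod_insert ha, Finset.prod_insert ha]
    exact (partialSum_mul_le N (hf a) (coeff_prod_nonneg s hf)).trans
      (mul_le_mul_of_nonneg_left ih (partialSum_nonneg N (hf a)))

theorem partialSum_X_pow_mul_le (N m : ℕ) (hm : m ≠ 0) {f : PowerSeries ℝ}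
    (hf : ∀ n, 0 ≤ f.coeff n) :
    partialSum (N + 1) (PowerSeries.X ^ m * f) ≤ partialSum N f := by
  obtain ⟨m, rfl⟩ := Nat.exists_eq_succ_of_ne_zero hm
  unfold partialSum
  rw [Finset.sum_range_succ']
  have : PowerSeries.coeff 0 (PowerSeries.X ^ (m + 1) * f) = 0 := by
    rw [PowerSeries.coeff_X_pow_mul']; simp
  rw [Nat.succ_eq_add_one, this, add_zero]
  have h : ∀ n ∈ Finset.range N, PowerSeries.coeff (n + 1) (PowerSeries.X ^ (m + 1) * f) =
      if m ≤ n then f.coeff (n - m) else 0 := fun n _ => by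
    rw [PowerSeries.coeff_X_pow_mul']; simp
  rw [Finset.sum_congr rfl h, ← Finset.sum_filter]
  refine sum_le_sum_of_injOn (fun n => n - m) ?_ ?_ (fun _ _ => rfl) hf
  · intro n h
    simp only [Finset.mem_filter, Finset.mem_range] at h ⊢
    omega
  · intro n h n' h' e
    simp only [Finset.coe_filter, Set.mem_ofPred_eq] at h h' e
    omega

theorem SolvesTreeEquation.coeff_eq_sum_treeTerm {c : Fin k → Multiset (Fin k) → ℝ}
    {P : Fin k → PowerSeries ℝ} (hP : SolvesTreeEquation c P) (j : Fin k) {n N : ℕ} (h : n ≤ N) :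
    (P j).coeff n = ∑ m ∈ Finset.range (N + 1),
      PowerSeries.coeff n (PowerSeries.X ^ m * treeTerm c P m j) := hP j n N h

theorem coeff_treeTerm (c : Fin k → Multiset (Fin k) → ℝ) (P : Fin k → PowerSeries ℝ) (m n : ℕ)
    (j : Fin k) : PowerSeries.coeff n (treeTerm c P m j) = 1 / (m.factorial : ℝ) *
      ∑ i : Fin m → Fin k, c j (Finset.univ.val.map i) * PowerSeries.coeff n (∏ a, P (i a)) := by
  rw [treeTerm, PowerSeries.coeff_C_mul, map_sum]
  simp_rw [PowerSeries.coeff_C_mul]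

theorem coeff_treeTerm_nonneg {c : Fin k → Multiset (Fin k) → ℝ} (hc : ∀ j s, 0 ≤ c j s)
    {P : Fin k → PowerSeries ℝ} (hP : ∀ j n, 0 ≤ (P j).coeff n) (m n : ℕ) (j : Fin k) :
    0 ≤ PowerSeries.coeff n (treeTerm c P m j) := by
  rw [coeff_treeTerm]
  exact mul_nonneg (by positivity) (Finset.sum_nonneg fun i _ => mul_nonneg (hc _ _)
    (coeff_prod_nonneg _ (fun a => hP (i a)) n))

theorem partialSum_treeTerm_le {c : Fin k → Multiset (Fin k) → ℝ} (hc : ∀ j s, 0 ≤ c j s)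
    {P : Fin k → PowerSeries ℝ} (hP : ∀ j n, 0 ≤ (P j).coeff n) {ε : ℝ} {N : ℕ}
    (h : ∀ j, partialSum N (P j) ≤ ε) (m : ℕ) (j : Fin k) :
    partialSum N (treeTerm c P m j) ≤ 1 / (m.factorial : ℝ) *
      ∑ i : Fin m → Fin k, c j (Finset.univ.val.map i) * ε ^ m := by
  unfold partialSum
  simp_rw [coeff_treeTerm]
  rw [← Finset.mul_sum, Finset.sum_comm]
  gcongr with i
  rw [← Finset.mul_sum]
  refine mul_le_mul_of_nonneg_left ?_ (hc _ _)
  refine (partialSum_prod_le Finset.univ N fun a n => hP (i a) n).trans ?_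
  refine (Finset.prod_le_prod (fun a _ => partialSum_nonneg N (hP _)) fun a _ => h (i a)).trans ?_
  simp

/-- Majorant induction. For m ≥ 1 the factor X^m means that the first N + 1 coefficients of the m-th
term involve only the first N coefficients of `P`, whose sums are already at most ε. Then `hb` says
that the numerical right-hand side at ε stays below ε. -/
theorem SolvesTreeEquation.partialSum_le {c : Fin k → Multiset (Fin k) → ℝ}
    (hc : ∀ j s, 0 ≤ c j s) {P : Fin k → PowerSeries ℝ} (hP : SolvesTreeEquation c P)
    (hP0 : ∀ j n, 0 ≤ (P j).coeff n) {ε : ℝ} (hε : 0 ≤ ε)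
    (hb : ∀ j N, ∑ m ∈ Finset.range N, 1 / (m.factorial : ℝ) *
      ∑ i : Fin m → Fin k, c j (Finset.univ.val.map i) * ε ^ m ≤ ε) (N : ℕ) (j : Fin k) :
    partialSum N (P j) ≤ ε := by
  induction N generalizing j with
  | zero => simpa [partialSum] using hε
  | succ N ih =>
    have h1 : partialSum (N + 1) (P j) = ∑ m ∈ Finset.range (N + 1),
        partialSum (N + 1) (PowerSeries.X ^ m * treeTerm c P m j) := by
      unfold partialSum
      rw [Finset.sum_comm]
      exact Finset.sum_congr rfl fun n hn =>
        hP.coeff_eq_sum_treeTerm j (Finset.mem_range_succ_iff.1 hn)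
    rw [h1]
    refine le_trans (Finset.sum_le_sum fun m _ => ?_) (hb j (N + 1))
    rcases eq_or_ne m 0 with rfl | hm
    · simp [partialSum, coeff_treeTerm, PowerSeries.coeff_one]
    · exact (partialSum_X_pow_mul_le N m hm (coeff_treeTerm_nonneg hc hP0 m · j)).trans
        (partialSum_treeTerm_le hc hP0 ih m j)

theorem abs_coeff_prod_le {ι : Type*} (s : Finset ι) {f g : ι → PowerSeries ℝ}
    (h : ∀ i n, |(f i).coeff n| ≤ (g i).coeff n) (n : ℕ) :
    |(∏ i ∈ s, f i).coeff n| ≤ (∏ i ∈ s, g i).coeff n := by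
  classical
  induction s using Finset.induction_on generalizing n with
  | empty => rw [Finset.prod_empty, Finset.prod_empty, PowerSeries.coeff_one]; split_ifs <;> simp
  | insert a s ha ih =>
    rw [Finset.prod_insert ha, Finset.prod_insert ha, PowerSeries.coeff_mul, PowerSeries.coeff_mul]
    refine (Finset.abs_sum_le_sum_abs _ _).trans (Finset.sum_le_sum fun p _ => ?_)
    rw [abs_mul]
    exact mul_le_mul (h _ _) (ih _) (abs_nonneg _) ((abs_nonneg _).trans (h _ _))

theorem hasSum_coeff_prod {ι : Type*} (s : Finset ι) {f : ι → PowerSeries ℝ}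
    (hf : ∀ i, Summable fun n => |(f i).coeff n|) :
    (Summable fun n => |(∏ i ∈ s, f i).coeff n|) ∧
      HasSum (fun n => (∏ i ∈ s, f i).coeff n) (∏ i ∈ s, ∑' n, (f i).coeff n) := by
  classical
  induction s using Finset.induction_on with
  | empty =>
    have h : ∀ n ∉ ({0} : Finset ℕ), PowerSeries.coeff n (1 : PowerSeries ℝ) = 0 := fun n hn => by
      rw [PowerSeries.coeff_one, if_neg (by simpa using hn)]
    simp only [Finset.prod_empty]
    refine ⟨summable_of_ne_finset_zero (s := {0}) fun n hn => by rw [h n hn, abs_zero], ?_⟩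
    have h4 := hasSum_sum_of_ne_finset_zero (L := SummationFilter.unconditional ℕ) h
    rwa [Finset.sum_singleton, PowerSeries.coeff_zero_one] at h4
  | insert a s ha ih =>
    simp only [Finset.prod_insert ha, PowerSeries.coeff_mul]
    have h1 : Summable fun n => ‖(f a).coeff n‖ := hf a
    have h2 : Summable fun n => ‖(∏ i ∈ s, f i).coeff n‖ := ih.1
    have h3 := summable_norm_sum_mul_antidiagonal_of_summable_norm h1 h2
    refine ⟨h3, ?_⟩
    rw [← ih.2.tsum_eq, tsum_mul_tsum_eq_tsum_sum_antidiagonal_of_summable_norm h1 h2]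
    exact h3.of_norm.hasSum

theorem hasSum_coeff_X_pow_mul (m : ℕ) {f : PowerSeries ℝ} {a : ℝ}
    (h : HasSum (fun n => f.coeff n) a) :
    HasSum (fun n => PowerSeries.coeff n (PowerSeries.X ^ m * f)) a := by
  rw [← hasSum_nat_add_iff' m]
  have : ∑ n ∈ Finset.range m, PowerSeries.coeff n (PowerSeries.X ^ m * f) = 0 :=
    Finset.sum_eq_zero fun n hn => by
      rw [PowerSeries.coeff_X_pow_mul', if_neg (by simpa using hn)]
  rw [this, sub_zero]
  simpa [PowerSeries.coeff_X_pow_mul'] using h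

/-- The coefficient sums of the solution solve the tree equation. -/
theorem SolvesTreeEquation.hasSum {c : Fin k → Multiset (Fin k) → ℝ}
    {P Q : Fin k → PowerSeries ℝ} (hP : SolvesTreeEquation c P)
    (hQ : SolvesTreeEquation (fun j s => |c j s|) Q) {ε : ℝ} (hε : 0 ≤ ε)
    (hb : ∀ j N, ∑ m ∈ Finset.range N, 1 / (m.factorial : ℝ) *
      ∑ i : Fin m → Fin k, |c j (Finset.univ.val.map i)| * ε ^ m ≤ ε) :
    (∀ j, Summable fun n => (Q j).coeff n) ∧ (∀ j, |∑' n, (P j).coeff n| ≤ ε) ∧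
    ∀ j, HasSum (fun m : ℕ => 1 / (m.factorial : ℝ) * ∑ i : Fin m → Fin k,
      c j (Finset.univ.val.map i) * ∏ a, ∑' n, (P (i a)).coeff n) (∑' n, (P j).coeff n) := by
  have hPQ : ∀ j n, |(P j).coeff n| ≤ (Q j).coeff n := hP.abs_coeff_le hQ
  have hQ0 : ∀ j n, 0 ≤ (Q j).coeff n := fun j n => (abs_nonneg _).trans (hPQ j n)
  have hQε : ∀ N j, partialSum N (Q j) ≤ ε :=
    hQ.partialSum_le (fun _ _ => abs_nonneg _) hQ0 hε hb
  have hQs : ∀ j, Summable fun n => (Q j).coeff n := fun j =>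
    summable_of_sum_range_le (hQ0 j) fun N => hQε N j
  have hPs : ∀ j, Summable fun n => |(P j).coeff n| := fun j =>
    (hQs j).of_nonneg_of_le (fun _ => abs_nonneg _) (hPQ j)
  refine ⟨hQs, fun j => ?_, fun j => ?_⟩
  · rw [← Real.norm_eq_abs]
    refine tsum_of_norm_bounded (hQs j).hasSum (hPQ j) |>.trans ?_
    exact Real.tsum_le_of_sum_range_le (hQ0 j) fun N => hQε N j
  -- `u (m, n)` is the share of the m-th term in the n-th coefficient. Columns sum to the
  -- coefficients of `P j`, rows to the terms of the numerical equation; domination by `w`, whose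
  -- finite sums are at most ε, permits the interchange.
  let u : ℕ × ℕ → ℝ := fun p =>
    PowerSeries.coeff p.2 (PowerSeries.X ^ p.1 * treeTerm c P p.1 j)
  let w : ℕ × ℕ → ℝ := fun p =>
    PowerSeries.coeff p.2 (PowerSeries.X ^ p.1 * treeTerm (fun j s => |c j s|) Q p.1 j)
  have hT0 : ∀ m n, 0 ≤ PowerSeries.coeff n (treeTerm (fun j s => |c j s|) Q m j) := fun m n =>
    coeff_treeTerm_nonneg (fun _ _ => abs_nonneg _) hQ0 m n j
  have hw0 : ∀ p, 0 ≤ w p := fun p => by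
    simp only [w, PowerSeries.coeff_X_pow_mul']
    split_ifs
    exacts [hT0 _ _, le_rfl]
  have huw : ∀ p, ‖u p‖ ≤ w p := fun p => by
    simp only [u, w, PowerSeries.coeff_X_pow_mul']
    split_ifs
    · rw [coeff_treeTerm, coeff_treeTerm, Real.norm_eq_abs, abs_mul, abs_of_nonneg (by positivity)]
      gcongr
      refine (Finset.abs_sum_le_sum_abs _ _).trans (Finset.sum_le_sum fun i _ => ?_)
      rw [abs_mul]
      gcongr
      exact abs_coeff_prod_le _ (fun a n => hPQ (i a) n) _
    · simp
  have hrow : ∀ m, HasSum (fun n => u (m, n)) (1 / (m.factorial : ℝ) * ∑ i : Fin m → Fin k,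
      c j (Finset.univ.val.map i) * ∏ a, ∑' n, (P (i a)).coeff n) := fun m => by
    refine hasSum_coeff_X_pow_mul m (f := treeTerm c P m j) ?_
    simp_rw [coeff_treeTerm]
    refine HasSum.mul_left _ (hasSum_sum fun i _ => HasSum.mul_left _ ?_)
    exact (hasSum_coeff_prod Finset.univ fun a => hPs (i a)).2
  have hsummable : Summable u := by
    refine Summable.of_norm_bounded ?_ huw
    refine summable_of_sum_le hw0 (c := ε) fun s => ?_
    obtain ⟨N, hN⟩ : ∃ N, s ⊆ Finset.range N ×ˢ Finset.range N := by
      refine ⟨s.sup (fun p => max p.1 p.2) + 1, fun p hp => ?_⟩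
      have := Finset.le_sup (f := fun p : ℕ × ℕ => max p.1 p.2) hp
      simp only [Finset.mem_product, Finset.mem_range]
      omega
    refine (Finset.sum_le_sum_of_subset_of_nonneg hN fun p _ _ => hw0 p).trans ?_
    rw [Finset.sum_product]
    refine le_trans (Finset.sum_le_sum fun m _ => ?_) (hb j N)
    refine le_trans ?_ (partialSum_treeTerm_le (fun _ _ => abs_nonneg _) hQ0 (hQε N) m j)
    rcases eq_or_ne m 0 with rfl | hm
    · simp [w, partialSum]
    · refine le_trans ?_ (partialSum_X_pow_mul_le N m hm (hT0 m))
      unfold partialSum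
      exact Finset.sum_le_sum_of_subset_of_nonneg (Finset.range_mono (Nat.le_succ N))
        fun n _ _ => hw0 (m, n)
  have h1 := hsummable.hasSum.prod_fiberwise hrow
  have hcol : ∀ n, HasSum (fun m => u (m, n)) ((P j).coeff n) := fun n => by
    rw [hP.coeff_eq_sum_treeTerm j le_rfl]
    refine hasSum_sum_of_ne_finset_zero (L := SummationFilter.unconditional ℕ) fun m hm => ?_
    simp only [u, PowerSeries.coeff_X_pow_mul']
    rw [if_neg (by simpa using hm)]
  have h2 := ((Equiv.prodComm ℕ ℕ).hasSum_iff.2 hsummable.hasSum).prod_fiberwise hcol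
  rw [h2.tsum_eq]
  exact h1

end ParentForest

/-! ### Cumulants and the Taylor expansion of the tilted means -/

/-- Equal multisets have equally large fibers, and matching the fibers gives the permutation. With
the symmetry of higher derivatives this makes cumulants functions of multisets of indices. -/
theorem exists_perm_comp_of_map_univ_eq {ι α : Type*} [Fintype ι] {f g : ι → α}
    (h : Finset.univ.val.map f = Finset.univ.val.map g) : ∃ σ : Equiv.Perm ι, f = g ∘ σ := by
  classical
  have hc : ∀ x, Fintype.card {a // f a = x} = Fintype.card {a // g a = x} := fun x => by
    have h1 := congrArg (Multiset.count x) h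
    rw [Multiset.count_map, Multiset.count_map] at h1
    rw [Fintype.card_subtype, Fintype.card_subtype]
    simp only [eq_comm (a := x)] at h1
    exact h1
  refine ⟨((Equiv.sigmaFiberEquiv f).symm.trans (Equiv.sigmaCongrRight fun x =>
    Fintype.equivOfCardEq (hc x))).trans (Equiv.sigmaFiberEquiv g), ?_⟩
  funext a
  exact ((Fintype.equivOfCardEq (hc (f a)) ⟨a, rfl⟩).2).symm

namespace KLConstraintProblem

variable {S : Type*} [Fintype S] {k : ℕ} (K : KLConstraintProblem S k)

/-- The unnormalized exponential tilt of the reference distribution. -/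
noncomputable def tilt (t : Fin k → ℝ) (s : S) : ℝ := K.q s * Real.exp (∑ i, t i * K.r i s)

/-- The moment generating function. -/
noncomputable def mgf (t : Fin k → ℝ) : ℝ := ∑ s, K.tilt t s

/-- The cumulant generating function. -/
noncomputable def cgf (t : Fin k → ℝ) : ℝ := Real.log (K.mgf t)

/-- The partial derivatives of the cumulant generating function, i.e. the expectations under the
tilted distribution. -/
noncomputable def tiltedMean (j : Fin k) (t : Fin k → ℝ) : ℝ := (∑ s, K.tilt t s * K.r j s) / K.mgf t

theorem tilt_pos (t : Fin k → ℝ) (s : S) : 0 < K.tilt t s :=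
  mul_pos (K.q_pos s) (Real.exp_pos _)

theorem nonempty (K : KLConstraintProblem S k) : Nonempty S := by
  by_contra h
  rw [not_nonempty_iff] at h
  simpa using K.q_sum

theorem mgf_pos (t : Fin k → ℝ) : 0 < K.mgf t := by
  have := K.nonempty
  exact Finset.sum_pos (fun s _ => K.tilt_pos t s) Finset.univ_nonempty

theorem tilt_zero : K.tilt 0 = K.q := by
  funext s
  simp [tilt]

theorem mgf_zero : K.mgf 0 = 1 := by
  simp [mgf, tilt_zero, K.q_sum]

theorem analyticAt_tilt (s : S) (t : Fin k → ℝ) : AnalyticAt ℝ (fun t => K.tilt t s) t := by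
  unfold tilt
  refine analyticAt_const.fun_mul (AnalyticAt.rexp' (Finset.analyticAt_fun_sum _ fun i _ => ?_))
  exact (ContinuousLinearMap.analyticAt (ContinuousLinearMap.proj (R := ℝ) i) t).fun_mul
    analyticAt_const

theorem analyticAt_mgf (t : Fin k → ℝ) : AnalyticAt ℝ K.mgf t :=
  Finset.analyticAt_fun_sum _ fun s _ => K.analyticAt_tilt s t

theorem analyticAt_cgf (t : Fin k → ℝ) : AnalyticAt ℝ K.cgf t :=
  (analyticAt_log (K.mgf_pos t)).fun_comp (K.analyticAt_mgf t)

theorem analyticAt_tiltedMean (j : Fin k) (t : Fin k → ℝ) : AnalyticAt ℝ (K.tiltedMean j) t :=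
  (Finset.analyticAt_fun_sum _ fun s _ => (K.analyticAt_tilt s t).fun_mul analyticAt_const).fun_div
    (K.analyticAt_mgf t) (K.mgf_pos t).ne'

theorem hasFDerivAt_tilt (s : S) (t : Fin k → ℝ) : HasFDerivAt (fun t => K.tilt t s)
    (K.tilt t s • ∑ i, K.r i s • ContinuousLinearMap.proj (R := ℝ) i) t := by
  have h1 : HasFDerivAt (fun t : Fin k → ℝ => ∑ i, t i * K.r i s)
      (∑ i, K.r i s • ContinuousLinearMap.proj (R := ℝ) (φ := fun _ : Fin k => ℝ) i) t :=
    HasFDerivAt.fun_sum fun i _ => (hasFDerivAt_apply i t).mul_const (K.r i s)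
  have h2 := (h1.exp).const_mul (K.q s)
  rw [smul_smul] at h2
  exact h2

theorem fderiv_tilt_single (s : S) (t : Fin k → ℝ) (j : Fin k) :
    fderiv ℝ (fun t => K.tilt t s) t (Pi.single j 1) = K.tilt t s * K.r j s := by
  rw [(K.hasFDerivAt_tilt s t).fderiv]
  simp [Pi.single_apply]

theorem fderiv_mgf_single (t : Fin k → ℝ) (j : Fin k) :
    fderiv ℝ K.mgf t (Pi.single j 1) = ∑ s, K.tilt t s * K.r j s := by
  unfold mgf
  rw [fderiv_fun_sum fun s _ => (K.analyticAt_tilt s t).differentiableAt]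
  simp [fderiv_tilt_single]

theorem fderiv_cgf_single (t : Fin k → ℝ) (j : Fin k) :
    fderiv ℝ K.cgf t (Pi.single j 1) = K.tiltedMean j t := by
  unfold cgf
  rw [fderiv.log (K.analyticAt_mgf t).differentiableAt (K.mgf_pos t).ne']
  simp only [smul_apply, fderiv_mgf_single, tiltedMean, smul_eq_mul]
  ring

theorem tiltedMean_zero (hK : K.Normalized) (j : Fin k) : K.tiltedMean j 0 = 0 := by
  have := hK.1 j
  unfold expect at this
  simp [tiltedMean, tilt_zero, this]

theorem fderiv_tiltedMean_zero (hK : K.Normalized) (i j : Fin k) :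
    fderiv ℝ (K.tiltedMean j) 0 (Pi.single i 1) = if i = j then 1 else 0 := by
  have h1 : HasFDerivAt (fun t => ∑ s, K.tilt t s * K.r j s) (fderiv ℝ _ 0) 0 :=
    (Finset.analyticAt_fun_sum _ fun s _ =>
      (K.analyticAt_tilt s 0).fun_mul analyticAt_const).differentiableAt.hasFDerivAt
  have h2 : HasFDerivAt K.mgf (fderiv ℝ _ 0) 0 := (K.analyticAt_mgf 0).differentiableAt.hasFDerivAt
  have h3 : fderiv ℝ (fun t => ∑ s, K.tilt t s * K.r j s) 0 (Pi.single i 1) =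
      if i = j then 1 else 0 := by
    rw [fderiv_fun_sum fun s _ => (K.analyticAt_tilt s 0).differentiableAt.mul_const _,
      ← hK.2 i j, expect, sum_apply]
    refine Finset.sum_congr rfl fun s _ => ?_
    rw [fderiv_mul_const (K.analyticAt_tilt s 0).differentiableAt]
    simp only [smul_apply, fderiv_tilt_single, tilt_zero, smul_eq_mul]
    ring
  have h4 : K.tiltedMean j = fun t => (∑ s, K.tilt t s * K.r j s) * (K.mgf t)⁻¹ := by
    funext t; rw [tiltedMean, div_eq_mul_inv]
  have h5 : ∑ s, K.q s * K.r j s = 0 := hK.1 j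
  have h6 : HasFDerivAt (fun t => (K.mgf t)⁻¹) (fderiv ℝ _ 0) 0 :=
    ((K.analyticAt_mgf 0).differentiableAt.fun_inv (K.mgf_pos 0).ne').hasFDerivAt
  rw [h4, (h1.fun_mul h6).fderiv]
  simp [h3, tilt_zero, h5, mgf_zero]

/-- The joint cumulant of the constraint functions `r (i 0), …, r (i (m - 1))`. -/
noncomputable def indexCumulant (m : ℕ) (i : Fin m → Fin k) : ℝ :=
  iteratedFDeriv ℝ m K.cgf 0 fun a => Pi.single (i a) 1

/-- The joint cumulant of a multiset of constraint functions. -/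
noncomputable def multisetCumulant (s : Multiset (Fin k)) : ℝ :=
  K.indexCumulant s.toList.length s.toList.get

theorem indexCumulant_eq (m : ℕ) (i : Fin m → Fin k) :
    K.indexCumulant m i = K.multisetCumulant (Finset.univ.val.map i) := by
  unfold multisetCumulant
  set l := (Finset.univ.val.map i).toList with hl
  have h : (l : Multiset (Fin k)) = Finset.univ.val.map i := Multiset.coe_toList _
  clear_value l
  have hlen : l.length = m := by simpa using congrArg Multiset.card h
  subst hlen
  have h2 : Finset.univ.val.map i = Finset.univ.val.map l.get := by
    rw [← h, Fin.univ_val_map, List.ofFn_get]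
  obtain ⟨σ, rfl⟩ := exists_perm_comp_of_map_univ_eq h2
  exact ContDiffAt.iteratedFDeriv_comp_perm (K.analyticAt_cgf 0).contDiffAt
    (fun a => Pi.single (l.get a) 1) σ

/-- The generating function of the family (r_{lab e})_e is `cgf` after the linear map sending the
basis vector at e to the one at lab e, so the chain rule transports the mixed derivative. Repeated
labels cause no trouble. -/
theorem jointCumulant_eq {ι : Type*} [Fintype ι] (lab : ι → Fin k) :
    jointCumulant K.q (fun e => K.r (lab e)) = K.multisetCumulant (Finset.univ.val.map lab) := by
  classical
  let M : (ι → ℝ) →L[ℝ] (Fin k → ℝ) := ∑ e, (ContinuousLinearMap.proj (R := ℝ) e).smulRight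
    (Pi.single (lab e) (1 : ℝ) : Fin k → ℝ)
  have hM : ∀ e, M (Pi.single e 1) = Pi.single (lab e) 1 := fun e => by
    simp [M, Pi.single_apply, ite_smul]
  have hM' : ∀ t s, ∑ i, M t i * K.r i s = ∑ e, t e * K.r (lab e) s := fun t s => by
    simp only [M, sum_apply, ContinuousLinearMap.smulRight_apply,
      Finset.sum_apply, Pi.smul_apply, smul_eq_mul, Finset.sum_mul, ContinuousLinearMap.proj_apply]
    rw [Finset.sum_comm]
    simp [Pi.single_apply]
  have hcomp : (fun t : ι → ℝ =>
      Real.log (expect K.q (fun s => Real.exp (∑ i, t i * K.r (lab i) s)))) = K.cgf ∘ M := by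
    funext t
    simp only [Function.comp, cgf, mgf, tilt, hM', expect]
  have hcd : ContDiff ℝ ⊤ K.cgf :=
    contDiff_iff_contDiffAt.2 fun t => (K.analyticAt_cgf t).contDiffAt
  unfold jointCumulant
  rw [hcomp, M.iteratedFDeriv_comp_right hcd 0 le_top]
  have : Finset.univ.val.map lab =
      Finset.univ.val.map fun m => lab ((Fintype.equivFin ι).symm m) := by
    rw [← Multiset.map_univ_val_equiv (Fintype.equivFin ι).symm, Multiset.map_map]
    rfl
  rw [this, ← K.indexCumulant_eq, indexCumulant]
  simp only [ContinuousMultilinearMap.compContinuousLinearMap_apply, map_zero]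
  congr 1
  funext m
  convert hM _

/-- The tilted mean is the j-th partial derivative of `cgf`, so one more derivative of `cgf` adds
the index j. -/
theorem iteratedFDeriv_tiltedMean (j : Fin k) (m : ℕ) (i : Fin m → Fin k) :
    iteratedFDeriv ℝ m (K.tiltedMean j) 0 (fun a => Pi.single (i a) 1) =
      K.multisetCumulant (j ::ₘ Finset.univ.val.map i) := by
  have h1 : K.tiltedMean j = (ContinuousLinearMap.apply ℝ ℝ (Pi.single j 1 : Fin k → ℝ)) ∘
      fun t => fderiv ℝ K.cgf t := by
    funext t; simp [fderiv_cgf_single]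
  have h2 : j ::ₘ Finset.univ.val.map i =
      Finset.univ.val.map (Fin.snoc i j : Fin (m + 1) → Fin k) := by
    rw [Fin.univ_val_map, Fin.univ_val_map, List.ofFn_succ_last, ← Multiset.coe_add, add_comm]
    simp
  rw [h2, ← K.indexCumulant_eq, indexCumulant, iteratedFDeriv_succ_apply_right, h1,
    ContinuousLinearMap.iteratedFDeriv_comp_left (n := ⊤) _ (K.analyticAt_cgf 0).fderiv.contDiffAt
      le_top]
  simp [Fin.init_def]

theorem multisetCumulant_singleton (hK : K.Normalized) (j : Fin k) :
    K.multisetCumulant {j} = 0 := by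
  have := K.iteratedFDeriv_tiltedMean j 0 Fin.elim0
  simpa [K.tiltedMean_zero hK] using this.symm

theorem multisetCumulant_pair (hK : K.Normalized) (i j : Fin k) :
    K.multisetCumulant {j, i} = if i = j then 1 else 0 := by
  have := K.iteratedFDeriv_tiltedMean j 1 fun _ => i
  rw [iteratedFDeriv_one_apply, K.fderiv_tiltedMean_zero hK] at this
  rw [this]
  simp

/-- Analyticity at 0 gives both the Taylor series and geometric bounds on its coefficients, the
latter needed for the majorant. The constants are made uniform in j at the end by sums and a
minimum. -/
theorem tiltedMean_expansion : ∃ C > 0, ∃ a > 0, ∃ δ > 0,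
    (∀ (j : Fin k) (m : ℕ) (i : Fin m → Fin k),
      |K.multisetCumulant (j ::ₘ Finset.univ.val.map i)| ≤ m.factorial * (C * a ^ m)) ∧
    ∀ t : Fin k → ℝ, ‖t‖ < δ → ∀ j, HasSum (fun m : ℕ => 1 / (m.factorial : ℝ) *
      ∑ i : Fin m → Fin k, K.multisetCumulant (j ::ₘ Finset.univ.val.map i) * ∏ a, t (i a))
      (K.tiltedMean j t) := by
  have hj : ∀ j, ∃ C > 0, ∃ a > 0, ∃ δ > 0,
    (∀ (m : ℕ) (i : Fin m → Fin k),
      |K.multisetCumulant (j ::ₘ Finset.univ.val.map i)| ≤ m.factorial * (C * a ^ m)) ∧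
    ∀ t : Fin k → ℝ, ‖t‖ < δ → HasSum (fun m : ℕ => 1 / (m.factorial : ℝ) *
      ∑ i : Fin m → Fin k, K.multisetCumulant (j ::ₘ Finset.univ.val.map i) * ∏ a, t (i a))
      (K.tiltedMean j t) := by
    intro j
    obtain ⟨p, r, hp⟩ := K.analyticAt_tiltedMean j 0
    obtain ⟨b, hb0, hb⟩ := ENNReal.lt_iff_exists_nnreal_btwn.1 hp.r_pos
    obtain ⟨C, hC, hpC⟩ := p.norm_mul_pow_le_of_lt_radius (hb.trans_le hp.r_le)
    have hb0' : (0 : ℝ) < b := by exact_mod_cast hb0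
    refine ⟨C, hC, (b : ℝ)⁻¹, by positivity, b, hb0', fun m i => ?_, fun t ht => ?_⟩
    -- The m-th derivative symmetrizes the m-th coefficient of the series: m! permutations, each
    -- contributing at most C b^{-m}.
    · rw [← iteratedFDeriv_tiltedMean, hp.iteratedFDeriv_eq_sum_of_completeSpace]
      refine (Finset.abs_sum_le_sum_abs _ _).trans ?_
      have : ∀ σ : Equiv.Perm (Fin m),
          |p m fun a => (Pi.single (i (σ a)) 1 : Fin k → ℝ)| ≤ C * (b : ℝ)⁻¹ ^ m := fun σ => by
        rw [← Real.norm_eq_abs]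
        refine ((p m).le_opNorm _).trans ?_
        have h1 : ∀ a, ‖(Pi.single (i (σ a)) 1 : Fin k → ℝ)‖ = 1 := fun a => by
          rw [Pi.norm_single]; simp
        simp only [h1, Finset.prod_const_one, mul_one]
        rw [inv_pow, ← div_eq_mul_inv, le_div_iff₀ (by positivity)]
        exact hpC m
      refine (Finset.sum_le_sum fun σ _ => this σ).trans ?_
      simp [Fintype.card_perm]
    · have hmem : t ∈ Metric.eball (0 : Fin k → ℝ) r := by
        rw [Metric.mem_eball, edist_zero_right]
        refine lt_trans ?_ hb
        rw [enorm_eq_nnnorm]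
        exact_mod_cast ht
      have h1 := hp.hasSum hmem
      rw [zero_add] at h1
      refine Eq.subst (motive := fun f : ℕ → ℝ => HasSum f (K.tiltedMean j t)) ?_ h1
      funext m
      have h2 := hp.factorial_smul t m
      have h3 : t = ∑ i, t i • (Pi.single i 1 : Fin k → ℝ) := by
        funext l; simp [Finset.sum_apply, Pi.single_apply]
      -- Multilinear expansion of the m-th derivative along t in the standard basis.
      have h4 : iteratedFDeriv ℝ m (K.tiltedMean j) 0 (fun _ => t) = ∑ i : Fin m → Fin k,
          K.multisetCumulant (j ::ₘ Finset.univ.val.map i) * ∏ a, t (i a) := by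
        conv_lhs => rw [h3]
        rw [ContinuousMultilinearMap.map_sum]
        refine Finset.sum_congr rfl fun i _ => ?_
        rw [ContinuousMultilinearMap.map_smul_univ, iteratedFDeriv_tiltedMean, smul_eq_mul,
          mul_comm]
      rw [← h4, ← h2, nsmul_eq_mul]
      have : (m.factorial : ℝ) ≠ 0 := by positivity
      field_simp
  choose C hC a ha δ hδ h1 h2 using hj
  rcases isEmpty_or_nonempty (Fin k) with hk | hk
  · exact ⟨1, one_pos, 1, one_pos, 1, one_pos, fun j => hk.elim j, fun _ _ j => hk.elim j⟩
  refine ⟨∑ j, C j, Finset.sum_pos (fun j _ => hC j) Finset.univ_nonempty, ∑ j, a j,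
    Finset.sum_pos (fun j _ => ha j) Finset.univ_nonempty, Finset.univ.inf' Finset.univ_nonempty δ,
    ?_, fun j m i => ?_, fun t ht j => h2 j t (ht.trans_le (Finset.inf'_le _ (Finset.mem_univ j)))⟩
  · simpa [Finset.lt_inf'_iff] using hδ
  · refine (h1 j m i).trans ?_
    have h3 : C j ≤ ∑ j, C j :=
      Finset.single_le_sum (fun j _ => (hC j).le) (Finset.mem_univ j)
    have h4 : a j ≤ ∑ j, a j :=
      Finset.single_le_sum (fun j _ => (ha j).le) (Finset.mem_univ j)
    have := (ha j).le
    have := (hC j).le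
    have := h3.trans' this
    gcongr

end KLConstraintProblem

/-! ### Gibbs' inequality, the minimizer and its parameters -/

/-- Pointwise Gibbs inequality with its equality case, from log x ≤ x - 1 at x = p/p'. The
correction p' - p sums to 0 over two probability distributions. -/
theorem mul_log_div_ge {p p' q : ℝ} (hp : 0 < p) (hp' : 0 ≤ p') (hq : 0 < q) :
    p' * Real.log (p / q) + (p' - p) ≤ p' * Real.log (p' / q) ∧
      (p' * Real.log (p' / q) ≤ p' * Real.log (p / q) + (p' - p) → p' = p) := by
  rcases hp'.eq_or_lt with rfl | h
  · constructor
    · simp [hp.le]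
    · intro h
      simp only [zero_mul, zero_sub, zero_add] at h
      linarith
  · have e : Real.log (p / q) = Real.log (p' / q) + Real.log (p / p') := by
      rw [← Real.log_mul (by positivity) (by positivity)]
      congr 1
      field_simp
    have e2 : p' * (p / p' - 1) = p - p' := by field_simp
    rw [e, mul_add]
    constructor
    · have := mul_le_mul_of_nonneg_left (Real.log_le_sub_one_of_pos (div_pos hp h)) hp'
      linarith
    · intro h1
      by_contra hne
      have hne' : p / p' ≠ 1 := fun h2 => hne ((div_eq_one_iff_eq h.ne').1 h2).symm
      have := mul_lt_mul_of_pos_left (Real.log_lt_sub_one_of_pos (div_pos hp h) hne') h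
      linarith

namespace KLConstraintProblem

variable {S : Type*} [Fintype S] {k : ℕ} (K : KLConstraintProblem S k)

/-- The exponential tilt of the reference distribution. -/
noncomputable def tilted (t : Fin k → ℝ) (s : S) : ℝ := K.tilt t s / K.mgf t

theorem tilted_pos (t : Fin k → ℝ) (s : S) : 0 < K.tilted t s :=
  div_pos (K.tilt_pos t s) (K.mgf_pos t)

theorem tilted_eq (t : Fin k → ℝ) (s : S) : K.tilted t s =
    K.q s * Real.exp (-1 - (Real.log (K.mgf t) - 1) - ∑ i, (-t) i * K.r i s) := by
  have h : -1 - (Real.log (K.mgf t) - 1) - ∑ i, (-t) i * K.r i s =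
      ∑ i, t i * K.r i s - Real.log (K.mgf t) := by
    simp only [Pi.neg_apply, neg_mul, Finset.sum_neg_distrib]
    ring
  rw [h, Real.exp_sub, Real.exp_log (K.mgf_pos t), tilted, tilt, mul_div_assoc]

theorem expect_tilted (t : Fin k → ℝ) (j : Fin k) :
    expect (K.tilted t) (K.r j) = K.tiltedMean j t := by
  simp only [expect, tilted, tiltedMean, Finset.sum_div]
  exact Finset.sum_congr rfl fun s _ => by ring

theorem tilted_mem_feasible {t ρ : Fin k → ℝ} (h : ∀ j, K.tiltedMean j t = ρ j) :
    K.tilted t ∈ K.feasible ρ := by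
  refine ⟨fun s => (K.tilted_pos t s).le, ?_, fun j => (K.expect_tilted t j).trans (h j)⟩
  simp only [tilted, ← Finset.sum_div]
  exact div_self (K.mgf_pos t).ne'

/-- The logarithm is affine in the constraint functions, so its expectation is the same for every
feasible distribution. -/
theorem sum_mul_log_tilted {t ρ : Fin k → ℝ} {P : S → ℝ} (hP : P ∈ K.feasible ρ) :
    ∑ s, P s * Real.log (K.tilted t s / K.q s) = ∑ i, t i * ρ i - Real.log (K.mgf t) := by
  have h1 : ∀ s, Real.log (K.tilted t s / K.q s) =
      ∑ i, t i * K.r i s - Real.log (K.mgf t) := fun s => by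
    rw [tilted, tilt, mul_div_assoc, mul_div_cancel_left₀ _ (K.q_pos s).ne',
      Real.log_div (Real.exp_ne_zero _) (K.mgf_pos t).ne', Real.log_exp]
  simp_rw [h1, mul_sub, Finset.sum_sub_distrib, ← Finset.sum_mul, hP.2.1, one_mul, Finset.mul_sum]
  rw [Finset.sum_comm]
  congr 1
  refine Finset.sum_congr rfl fun i _ => ?_
  rw [← hP.2.2 i, expect, Finset.mul_sum]
  exact Finset.sum_congr rfl fun s _ => by ring

/-- Pythagorean identity: for feasible P', D(P'‖q) - D(tilted‖q) equals D(P'‖tilted), which is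
nonnegative and vanishes only at the tilt. Here it is carried out termwise, so feasible
distributions with zeros are included. -/
theorem isMinimizer_iff {t ρ : Fin k → ℝ} (h : ∀ j, K.tiltedMean j t = ρ j) (P : S → ℝ) :
    K.IsMinimizer ρ P ↔ P = K.tilted t := by
  have hmem := K.tilted_mem_feasible h
  have key : ∀ P' ∈ K.feasible ρ, klDivergence (K.tilted t) K.q ≤ klDivergence P' K.q ∧
      (klDivergence P' K.q ≤ klDivergence (K.tilted t) K.q → P' = K.tilted t) := by
    intro P' hP'
    have h0 : klDivergence (K.tilted t) K.q =
        ∑ s, (P' s * Real.log (K.tilted t s / K.q s) + (P' s - K.tilted t s)) := by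
      rw [Finset.sum_add_distrib, Finset.sum_sub_distrib, hP'.2.1, hmem.2.1,
        K.sum_mul_log_tilted hP', ← K.sum_mul_log_tilted hmem, klDivergence]
      ring
    have h1 := fun s => mul_log_div_ge (K.tilted_pos t s) (hP'.1 s) (K.q_pos s)
    have h2 : klDivergence (K.tilted t) K.q ≤ klDivergence P' K.q := by
      rw [h0]
      exact Finset.sum_le_sum fun s _ => (h1 s).1
    refine ⟨h2, fun h3 => funext fun s => (h1 s).2 ?_⟩
    have h4 := (Finset.sum_eq_sum_iff_of_le fun s _ => (h1 s).1).1
      (h0.symm.trans (h2.antisymm h3))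
    exact (h4 s (Finset.mem_univ s)).ge
  constructor
  · rintro ⟨h1, h2⟩
    exact (key P h1).2 (h2 _ hmem)
  · rintro rfl
    exact ⟨hmem, fun P' hP' => (key P' hP').1⟩

/-- Two parameter vectors for the same distribution differ by a combination of the r_i that is
constant on S. The constant is 0 because the r_i have mean 0 under Q, and linear independence
finishes. -/
theorem isExponentialParameters_iff (hK : K.Normalized) {t ρ : Fin k → ℝ}
    (h : ∀ j, K.tiltedMean j t = ρ j) (lam : Fin k → ℝ) :
    K.IsExponentialParameters ρ lam ↔ lam = -t := by
  constructor
  · rintro ⟨P, hP, lam₀, hlam⟩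
    rw [K.isMinimizer_iff h] at hP
    subst hP
    have h1 : ∀ s, ∑ i, (lam i + t i) * K.r i s = Real.log (K.mgf t) - 1 - lam₀ := fun s => by
      have h2 := hlam s
      rw [tilted_eq] at h2
      have h3 := Real.exp_injective (mul_left_cancel₀ (K.q_pos s).ne' h2)
      simp only [Pi.neg_apply, neg_mul, Finset.sum_neg_distrib] at h3
      simp only [add_mul, Finset.sum_add_distrib]
      linarith
    have h4 : ∑ s, K.q s * ∑ i, (lam i + t i) * K.r i s = 0 := by
      simp_rw [Finset.mul_sum]
      rw [Finset.sum_comm]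
      refine Finset.sum_eq_zero fun i _ => ?_
      have h5 : ∑ s, K.q s * K.r i s = 0 := hK.1 i
      rw [← mul_zero (lam i + t i), ← h5, Finset.mul_sum]
      exact Finset.sum_congr rfl fun s _ => by ring
    simp_rw [h1, ← Finset.sum_mul, K.q_sum, one_mul] at h4
    have h6 : ∑ i, (lam i + t i) • K.r i = 0 := by
      funext s
      simpa [Finset.sum_apply, h4] using h1 s
    funext i
    have := Fintype.linearIndependent_iff.1 K.r_indep _ h6 i
    simp only [Pi.neg_apply]
    linarith
  · rintro rfl
    exact ⟨_, (K.isMinimizer_iff h _).2 rfl, _, K.tilted_eq t⟩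

theorem expParam_eq (hK : K.Normalized) {t ρ : Fin k → ℝ}
    (h : ∀ j, K.tiltedMean j t = ρ j) : K.expParam ρ = -t :=
  (K.isExponentialParameters_iff hK h _).1
    (Classical.epsilon_spec (p := K.IsExponentialParameters ρ)
      ⟨-t, (K.isExponentialParameters_iff hK h _).2 rfl⟩)

/-! ### The fixed-point equation for the exponential parameters -/

/-- The weight of a vertex whose parent edge is labeled by `j` and whose child edges are labeled by
the multiset `s`. -/
noncomputable def vertexWeight (ρ : Fin k → ℝ) (j : Fin k) (s : Multiset (Fin k)) : ℝ :=
  if s.card = 0 then -ρ j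
  else if s.card = 1 then 0 else (-1) ^ s.card * K.multisetCumulant (j ::ₘ s)

theorem vertexWeight_zero (ρ : Fin k → ℝ) (j : Fin k) (i : Fin 0 → Fin k) :
    K.vertexWeight ρ j (Finset.univ.val.map i) = -ρ j := by simp [vertexWeight]

theorem vertexWeight_one (ρ : Fin k → ℝ) (j : Fin k) (i : Fin 1 → Fin k) :
    K.vertexWeight ρ j (Finset.univ.val.map i) = 0 := by simp [vertexWeight]

theorem vertexWeight_add_two (ρ : Fin k → ℝ) (j : Fin k) (m : ℕ) (i : Fin (m + 2) → Fin k) :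
    K.vertexWeight ρ j (Finset.univ.val.map i) =
      (-1) ^ (m + 2) * K.multisetCumulant (j ::ₘ Finset.univ.val.map i) := by
  simp only [vertexWeight, Multiset.card_map, Finset.card_val, Finset.card_univ, Fintype.card_fin]
  rw [if_neg (by omega), if_neg (by omega)]

/-- In the difference of the two series all terms with m ≥ 2 cancel, the sign in `vertexWeight`
being that of ∏(-λ). The terms m = 0 and m = 1 leave ρ_j and -λ_j, since κ(r_j) = 0 and κ(r_j, r_i)
= δ_ij. -/
theorem tiltedMean_neg_eq (hK : K.Normalized) {ρ lam : Fin k → ℝ} {j : Fin k}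
    (h1 : HasSum (fun m : ℕ => 1 / (m.factorial : ℝ) *
      ∑ i : Fin m → Fin k, K.multisetCumulant (j ::ₘ Finset.univ.val.map i) * ∏ a, (-lam) (i a))
      (K.tiltedMean j (-lam)))
    (h2 : HasSum (fun m : ℕ => 1 / (m.factorial : ℝ) * ∑ i : Fin m → Fin k,
      K.vertexWeight ρ j (Finset.univ.val.map i) * ∏ a, lam (i a)) (lam j)) :
    K.tiltedMean j (-lam) = ρ j := by
  have h3 := h1.sub h2
  have h4 := hasSum_sum_of_ne_finset_zero (L := SummationFilter.unconditional ℕ)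
    (s := Finset.range 2) (f := fun m : ℕ => 1 / (m.factorial : ℝ) *
      ∑ i : Fin m → Fin k, K.multisetCumulant (j ::ₘ Finset.univ.val.map i) * ∏ a, (-lam) (i a) -
      1 / (m.factorial : ℝ) * ∑ i : Fin m → Fin k,
      K.vertexWeight ρ j (Finset.univ.val.map i) * ∏ a, lam (i a)) (by
    intro m hm
    obtain ⟨m, rfl⟩ : ∃ m', m = m' + 2 := ⟨m - 2, by simp at hm; omega⟩
    rw [sub_eq_zero]
    congr 1
    refine Finset.sum_congr rfl fun i _ => ?_
    rw [vertexWeight_add_two]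
    have : ∏ a, (-lam) (i a) = (-1) ^ (m + 2) * ∏ a, lam (i a) := by
      simp [Finset.prod_neg]
    rw [this]
    ring)
  have h5 := h3.unique h4
  have h6 : ∑ i : Fin 1 → Fin k, K.multisetCumulant (j ::ₘ Finset.univ.val.map i) *
      ∏ a, (-lam) (i a) = -lam j := by
    rw [← (Equiv.funUnique (Fin 1) (Fin k)).symm.sum_comp]
    have h7 : ∀ i : Fin k, K.multisetCumulant (j ::ₘ Finset.univ.val.map
        ((Equiv.funUnique (Fin 1) (Fin k)).symm i)) = if i = j then 1 else 0 := fun i => by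
      rw [← K.multisetCumulant_pair hK]; simp
    simp_rw [h7]
    simp
  rw [Finset.sum_range_succ, Finset.sum_range_one, h6] at h5
  simp only [vertexWeight_zero, vertexWeight_one] at h5
  simp [K.multisetCumulant_singleton hK] at h5
  linarith

/-- For small `ρ` the vertex weights satisfy the bounds that make the tree series converge. -/
theorem exists_vertexWeight_bound {C a δ : ℝ} (hC : 0 < C) (ha : 0 < a) (hδ : 0 < δ)
    (h : ∀ (j : Fin k) (m : ℕ) (i : Fin m → Fin k),
      |K.multisetCumulant (j ::ₘ Finset.univ.val.map i)| ≤ m.factorial * (C * a ^ m)) :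
    ∃ ε > 0, ε < δ ∧ ∀ ρ : Fin k → ℝ, ‖ρ‖ < ε / 2 → ∀ j N,
      ∑ m ∈ Finset.range N, 1 / (m.factorial : ℝ) * ∑ i : Fin m → Fin k,
        |K.vertexWeight ρ j (Finset.univ.val.map i)| * ε ^ m ≤ ε := by
  set b : ℝ := k * a with hb
  have hb0 : 0 ≤ b := by positivity
  -- The third condition makes the tail m ≥ 2 geometric. The fourth makes this tail, quadratic in ε,
  -- at most ε/2; the other half of ε is left for |ρ_j|.
  obtain ⟨ε, hε, hεδ, hε1, hε2⟩ : ∃ ε : ℝ, 0 < ε ∧ ε < δ ∧ b * ε ≤ 1 / 2 ∧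
      16 * C * b ^ 2 * ε ≤ 1 := by
    refine ⟨min (δ / 2) (min (1 / (2 * b + 1)) (1 / (16 * C * b ^ 2 + 1))), by positivity,
      (min_le_left _ _).trans_lt (by linarith), ?_, ?_⟩
    · have h1 : min (δ / 2) (min (1 / (2 * b + 1)) (1 / (16 * C * b ^ 2 + 1))) ≤
        1 / (2 * b + 1) := (min_le_right _ _).trans (min_le_left _ _)
      refine (mul_le_mul_of_nonneg_left h1 hb0).trans ?_
      rw [mul_one_div, div_le_div_iff₀ (by positivity) (by positivity)]
      linarith
    · have h1 : min (δ / 2) (min (1 / (2 * b + 1)) (1 / (16 * C * b ^ 2 + 1))) ≤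
        1 / (16 * C * b ^ 2 + 1) := (min_le_right _ _).trans (min_le_right _ _)
      refine (mul_le_mul_of_nonneg_left h1 (by positivity)).trans ?_
      rw [mul_one_div, div_le_one (by positivity)]
      linarith
  refine ⟨ε, hε, hεδ, fun ρ hρ j N => ?_⟩
  -- For m ≥ 2 the term is at most C(bε)^m, and the 4 makes up for writing (1/2)^m instead of
  -- (1/2)^(m-2).
  have hterm : ∀ m : ℕ, 1 / (m.factorial : ℝ) * ∑ i : Fin m → Fin k,
      |K.vertexWeight ρ j (Finset.univ.val.map i)| * ε ^ m ≤
      (if m = 0 then ε / 2 else 0) + 4 * C * (b * ε) ^ 2 * (1 / 2) ^ m := by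
    intro m
    match m with
    | 0 =>
      simp only [vertexWeight_zero]
      have := norm_le_pi_norm ρ j
      rw [Real.norm_eq_abs] at this
      simp only [abs_neg, pow_zero, mul_one, Finset.sum_const, Finset.card_univ, Fintype.card_pi,
        Finset.univ_eq_empty, Finset.prod_empty, one_smul, Nat.factorial_zero, Nat.cast_one,
        div_one, one_mul, if_true]
      have : 0 ≤ 4 * C * (b * ε) ^ 2 := by positivity
      linarith
    | 1 =>
      simp only [vertexWeight_one]
      simp
      positivity
    | m + 2 =>
      simp only [vertexWeight_add_two, abs_mul, abs_pow, abs_neg, abs_one, one_pow, one_mul]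
      rw [if_neg (by omega), zero_add]
      have h1 : ∑ i : Fin (m + 2) → Fin k,
          |K.multisetCumulant (j ::ₘ Finset.univ.val.map i)| * ε ^ (m + 2) ≤
          ∑ i : Fin (m + 2) → Fin k, (m + 2).factorial * (C * a ^ (m + 2)) * ε ^ (m + 2) :=
        Finset.sum_le_sum fun i _ => mul_le_mul_of_nonneg_right (h j _ i) (by positivity)
      refine (mul_le_mul_of_nonneg_left h1 (by positivity)).trans ?_
      have h2 : 1 / ((m + 2).factorial : ℝ) * ∑ i : Fin (m + 2) → Fin k,
          (m + 2).factorial * (C * a ^ (m + 2)) * ε ^ (m + 2) =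
          C * (b * ε) ^ 2 * (b * ε) ^ m := by
        have : ((m + 2).factorial : ℝ) ≠ 0 := by positivity
        simp only [Finset.sum_const, Finset.card_univ, Fintype.card_pi, Fintype.card_fin,
          Finset.prod_const, nsmul_eq_mul, Nat.cast_pow, hb]
        field_simp
        ring
      rw [h2]
      have h3 : (b * ε) ^ m ≤ (1 / 2) ^ m := pow_le_pow_left₀ (by positivity) hε1 m
      calc C * (b * ε) ^ 2 * (b * ε) ^ m ≤ C * (b * ε) ^ 2 * (1 / 2) ^ m := by gcongr
        _ = 4 * C * (b * ε) ^ 2 * (1 / 2) ^ (m + 2) := by ring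
  refine (Finset.sum_le_sum fun m _ => hterm m).trans ?_
  rw [Finset.sum_add_distrib, ← Finset.mul_sum]
  have h1 : ∑ m ∈ Finset.range N, (if m = 0 then ε / 2 else 0) ≤ ε / 2 := by
    rw [Finset.sum_ite_eq']
    split_ifs <;> linarith
  have h2 : 4 * C * (b * ε) ^ 2 * ∑ m ∈ Finset.range N, (1 / 2 : ℝ) ^ m ≤
      4 * C * (b * ε) ^ 2 * 2 :=
    mul_le_mul_of_nonneg_left (sum_geometric_two_le N) (by positivity)
  have h3 : 4 * C * (b * ε) ^ 2 * 2 = 16 * C * b ^ 2 * ε * (ε / 2) := by ring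
  have h4 := mul_le_mul_of_nonneg_right hε2 (half_pos hε).le
  linarith

/-- Near the origin the exponential parameters are the coefficient sums of the solution of the tree
equation. -/
theorem exists_expParam_eq_tsum (hK : K.Normalized) : ∃ δ > 0, ∀ ρ : Fin k → ℝ, ‖ρ‖ < δ →
    ∃ P Q : Fin k → PowerSeries ℝ,
      ParentForest.SolvesTreeEquation (K.vertexWeight ρ) P ∧
      ParentForest.SolvesTreeEquation (fun j s => |K.vertexWeight ρ j s|) Q ∧
      (∀ j, Summable fun n => (Q j).coeff n) ∧
      (∀ j, K.tiltedMean j (-fun i => ∑' n, (P i).coeff n) = ρ j) := by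
  obtain ⟨C, hC, a, ha, δ, hδ, hbound, hsum⟩ := K.tiltedMean_expansion
  obtain ⟨ε, hε, hεδ, hw⟩ := K.exists_vertexWeight_bound hC ha hδ hbound
  refine ⟨ε / 2, half_pos hε, fun ρ hρ => ?_⟩
  obtain ⟨P, hP⟩ := ParentForest.exists_solvesTreeEquation (K.vertexWeight ρ)
  obtain ⟨Q, hQ⟩ := ParentForest.exists_solvesTreeEquation fun j s => |K.vertexWeight ρ j s|
  obtain ⟨h1, h2, h3⟩ := hP.hasSum hQ hε.le (hw ρ hρ)
  refine ⟨P, Q, hP, hQ, h1, fun j => K.tiltedMean_neg_eq hK (hsum _ ?_ j) (h3 j)⟩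
  rw [norm_neg]
  exact ((pi_norm_le_iff_of_nonneg hε.le).2 h2).trans_lt hεδ

end KLConstraintProblem

/-! ### Parent functions and rooted trees -/

namespace ParentForest

variable {V : Type*}

/-- The graph of a parent function. -/
def parentGraph (f : V → V) : SimpleGraph V := SimpleGraph.fromRel fun u v => f u = v

theorem parentGraph_adj {f : V → V} {u v : V} :
    (parentGraph f).Adj u v ↔ u ≠ v ∧ (f u = v ∨ f v = u) := by
  simp [parentGraph]

variable [DecidableEq V] [Fintype V] {o : V} {f g : V → V}

theorem isForest_erase_iff : IsForest (Finset.univ.erase o) {o} f ↔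
    f o = o ∧ ∀ B : Finset V, o ∉ B → (∀ v ∈ B, f v ∈ B) → B = ∅ := by
  simp only [IsForest, Finset.mem_erase, Finset.mem_univ, and_true, not_not, forall_eq,
    Finset.subset_erase, Finset.subset_univ, true_and, Finset.mem_union, Finset.mem_singleton]
  refine and_congr_right fun _ => ⟨fun h => h.2, fun h => ⟨fun v _ => ?_, h⟩⟩
  tauto

theorem IsForest.map_root (hf : IsForest (Finset.univ.erase o) {o} f) : f o = o :=
  (isForest_erase_iff.1 hf).1

/-- Replaces induction along the path to the root: applied to a set of counterexamples, it yields
one whose parent is not a counterexample. -/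
theorem IsForest.not_closed (hf : IsForest (Finset.univ.erase o) {o} f) {B : Finset V}
    (hB : B.Nonempty) (ho : o ∉ B) : ∃ v ∈ B, f v ∉ B := by
  by_contra! h
  exact hB.ne_empty ((isForest_erase_iff.1 hf).2 B ho h)

theorem IsForest.map_ne (hf : IsForest (Finset.univ.erase o) {o} f) {v : V} (hv : v ≠ o) :
    f v ≠ v := fun h => by
  obtain ⟨w, hw, hw'⟩ := hf.not_closed (Finset.singleton_nonempty v) (by simpa using hv.symm)
  rw [Finset.mem_singleton] at hw
  subst hw
  exact hw' (by simp [h])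

theorem IsForest.map_map_ne (hf : IsForest (Finset.univ.erase o) {o} f) {v : V} (hv : v ≠ o) :
    f (f v) ≠ v := fun h => by
  have hfv : f v ≠ o := fun e => by
    rw [e, hf.map_root] at h
    exact hv h.symm
  obtain ⟨w, hw, hw'⟩ := hf.not_closed (B := {v, f v}) (by simp) (by
    simp [hv.symm, hfv.symm])
  simp only [Finset.mem_insert, Finset.mem_singleton] at hw hw'
  rcases hw with rfl | rfl <;> simp [h] at hw'

theorem IsForest.adj (hf : IsForest (Finset.univ.erase o) {o} f) {v : V} (hv : v ≠ o) :
    (parentGraph f).Adj v (f v) := parentGraph_adj.2 ⟨(hf.map_ne hv).symm, Or.inl rfl⟩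

theorem IsForest.connected (hf : IsForest (Finset.univ.erase o) {o} f) :
    (parentGraph f).Connected := by
  classical
  have h : ∀ v, (parentGraph f).Reachable v o := by
    by_contra! h
    obtain ⟨v, hv⟩ := h
    obtain ⟨w, hw, hw'⟩ := hf.not_closed
      (B := Finset.univ.filter fun v => ¬ (parentGraph f).Reachable v o) ⟨v, by simpa using hv⟩
      (by simp)
    simp only [Finset.mem_filter, Finset.mem_univ, true_and, not_not] at hw hw'
    have hwo : w ≠ o := fun e => hw (e ▸ SimpleGraph.Reachable.refl _)
    exact hw ((hf.adj hwo).reachable.trans hw')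
  have : Nonempty V := ⟨o⟩
  exact ⟨fun u v => (h u).trans (h v).symm⟩

theorem IsForest.edge_injective (hf : IsForest (Finset.univ.erase o) {o} f) {v w : V}
    (hv : v ≠ o) (h : s(v, f v) = s(w, f w)) : v = w := by
  rw [Sym2.eq_iff] at h
  rcases h with h | ⟨h1, h2⟩
  · exact h.1
  · exact absurd (by rw [h2, ← h1]) (hf.map_map_ne hv)

theorem IsForest.mem_edgeSet_iff (hf : IsForest (Finset.univ.erase o) {o} f) (e : Sym2 V) :
    e ∈ (parentGraph f).edgeSet ↔ ∃ v, v ≠ o ∧ s(v, f v) = e := by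
  induction e with
  | _ u v =>
  rw [SimpleGraph.mem_edgeSet]
  constructor
  · intro h
    rw [parentGraph_adj] at h
    obtain ⟨hne, h | h⟩ := h
    · exact ⟨u, fun e => hne (by rw [← h, e, hf.map_root]), by rw [h]⟩
    · exact ⟨v, fun e => hne (by rw [← h, e, hf.map_root]), by rw [h, Sym2.eq_swap]⟩
  · rintro ⟨w, hw, h⟩
    rw [← SimpleGraph.mem_edgeSet, ← h]
    exact hf.adj hw

/-- The edges of the graph of a parent function correspond to the vertices that are not the root. -/
noncomputable def IsForest.edgeEquiv (hf : IsForest (Finset.univ.erase o) {o} f) :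
    {v // v ≠ o} ≃ (parentGraph f).edgeSet :=
  Equiv.ofBijective (fun v => ⟨s(v.1, f v), hf.adj v.2⟩)
    ⟨fun v w h => Subtype.ext (hf.edge_injective v.2 (congrArg Subtype.val h)), fun e => by
      obtain ⟨v, hv, h⟩ := (hf.mem_edgeSet_iff e).1 e.2
      exact ⟨⟨v, hv⟩, Subtype.ext h⟩⟩

/-- A connected graph is a tree once it has one edge fewer than vertices, and here each non-root
vertex owns the edge to its parent. -/
theorem IsForest.isTree (hf : IsForest (Finset.univ.erase o) {o} f) :
    (parentGraph f).IsTree := by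
  rw [SimpleGraph.isTree_iff_connected_and_card]
  refine ⟨hf.connected, ?_⟩
  rw [← Nat.card_congr hf.edgeEquiv, Nat.card_eq_fintype_card, Nat.card_eq_fintype_card,
    Fintype.card_subtype_compl, Fintype.card_subtype_eq]
  have : 0 < Fintype.card V := Fintype.card_pos_iff.2 ⟨o⟩
  omega

/-- Take w with f w ≠ g w but with f and g equal at f w. The edge from w to f w must be a parent
edge of g, so g(f w) = w, making a 2-cycle of f. -/
theorem IsForest.eq_of_parentGraph_eq (hf : IsForest (Finset.univ.erase o) {o} f)
    (hg : IsForest (Finset.univ.erase o) {o} g) (h : parentGraph f = parentGraph g) : f = g := by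
  classical
  by_contra hne
  obtain ⟨v, hv⟩ := Function.ne_iff.1 hne
  obtain ⟨w, hw, hw'⟩ := hf.not_closed (B := Finset.univ.filter fun v => f v ≠ g v)
    ⟨v, by simpa using hv⟩ (by simp [hf.map_root, hg.map_root])
  simp only [Finset.mem_filter, Finset.mem_univ, true_and, not_not] at hw hw'
  have hwo : w ≠ o := fun e => hw (by rw [e, hf.map_root, hg.map_root])
  have := hf.adj hwo
  rw [h, parentGraph_adj] at this
  rcases this.2 with h1 | h1
  · exact hw h1.symm
  · exact hf.map_map_ne hwo (hw'.trans h1)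

/-- The parent is a neighbor closer to `o`; acyclicity holds since the distance strictly drops. The
resulting connected subgraph is all of `G`, as a tree is minimal among connected graphs. -/
theorem exists_isForest_of_isTree {G : SimpleGraph V} (hG : G.IsTree) (o : V) :
    ∃ f, IsForest (Finset.univ.erase o) {o} f ∧ parentGraph f = G := by
  have hc := hG.connected
  have hex : ∀ v, v ≠ o → ∃ w, G.Adj v w ∧ G.dist w o < G.dist v o := by
    intro v hv
    obtain ⟨p, hp⟩ := hc.exists_walk_length_eq_dist v o
    cases p with
    | nil => exact absurd rfl hv
    | cons h p =>
      refine ⟨_, h, ?_⟩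
      rw [← hp, SimpleGraph.Walk.length_cons]
      exact Nat.lt_succ_of_le (SimpleGraph.dist_le p)
  choose! f hadj hdist using hex
  let f' : V → V := Function.update f o o
  have hf' : ∀ v, v ≠ o → f' v = f v := fun v hv => Function.update_of_ne hv _ _
  have hfo : f' o = o := Function.update_self _ _ _
  have hF : IsForest (Finset.univ.erase o) {o} f' := by
    refine isForest_erase_iff.2 ⟨hfo, fun B ho hB => ?_⟩
    by_contra hne
    obtain ⟨v, hv, hmin⟩ := B.exists_min_image (fun v => G.dist v o)
      (Finset.nonempty_iff_ne_empty.2 hne)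
    have hvo : v ≠ o := fun e => ho (e ▸ hv)
    have h1 := hB v hv
    rw [hf' v hvo] at h1
    exact absurd (hmin _ h1) (not_le.2 (hdist v hvo))
  have hle : parentGraph f' ≤ G := by
    intro u v h
    rw [← SimpleGraph.mem_edgeSet, hF.mem_edgeSet_iff] at h
    obtain ⟨w, hw, h⟩ := h
    rw [← SimpleGraph.mem_edgeSet, ← h, hf' w hw]
    exact hadj w hw
  exact ⟨f', hF, le_antisymm hle
    ((SimpleGraph.isTree_iff_minimal_connected.1 hG).2 hF.connected hle)⟩

end ParentForest

/-! ### Labeled trees as parent functions with labels -/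

namespace LabeledTree

open ParentForest

variable {k : ℕ}

/-- The multiset of the labels of the edges at `v`. -/
noncomputable def labels (T : LabeledTree k) (v : Fin T.n) : Multiset (Fin k) :=
  Finset.univ.val.map fun e : T.IncidentEdge v => T.label e

theorem labels_eq_map_of_equiv (T : LabeledTree k) (v : Fin T.n) {ι : Type*} [Fintype ι]
    (e : ι ≃ T.IncidentEdge v) : T.labels v = Finset.univ.val.map fun u => T.label (e u) := by
  rw [labels, ← Multiset.map_univ_val_equiv e, Multiset.map_map]
  rfl

theorem card_labels (T : LabeledTree k) (v : Fin T.n) : (T.labels v).card = T.valency v := by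
  have h1 : (T.labels v).card = Nat.card (T.IncidentEdge v) := by
    rw [labels, Multiset.card_map, Nat.card_eq_fintype_card]; rfl
  rw [h1, valency, ← Nat.card_coe_set_eq, ← Nat.card_congr
    (T.graph.incidenceSetEquivNeighborSet v)]
  exact Nat.card_congr (Equiv.subtypeSubtypeEquivSubtypeInter
    (· ∈ T.graph.edgeSet) (fun e : Sym2 (Fin T.n) => v ∈ e))

theorem card_labels_out (T : LabeledTree k) : (T.labels T.out).card = 1 := by
  rw [card_labels]; exact T.out_leaf

/-- Parent functions and labels describing a labeled tree with `n` vertices. The label of the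
distinguished leaf is fixed to be `j`. -/
structure ParentData (j : Fin k) (n : ℕ) where
  out : Fin n
  parent : Fin n → Fin n
  lab : Fin n → Fin k
  isForest : IsForest (Finset.univ.erase out) {out} parent
  lab_out : lab out = j
  card_children_out : (children (Finset.univ.erase out) parent out).card = 1

namespace ParentData

variable {j : Fin k} {n : ℕ} (d : ParentData j n)

/-- The labels of the edges from `v` to its children. -/
def childLabels (v : Fin n) : Multiset (Fin k) :=
  (children (Finset.univ.erase d.out) d.parent v).val.map d.lab

theorem mem_children_out {v : Fin n} :
    v ∈ children (Finset.univ.erase d.out) d.parent d.out ↔ v ≠ d.out ∧ d.parent v = d.out := by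
  simp [mem_children]

theorem neighborSet_out : (parentGraph d.parent).neighborSet d.out =
    children (Finset.univ.erase d.out) d.parent d.out := by
  ext v
  rw [SimpleGraph.mem_neighborSet, parentGraph_adj, d.isForest.map_root, Finset.mem_coe,
    d.mem_children_out]
  tauto

/-- The labeled tree described by a parent function and labels. -/
noncomputable def toTree : LabeledTree k where
  n := n
  graph := parentGraph d.parent
  isTree := d.isForest.isTree
  out := d.out
  out_leaf := by rw [neighborSet_out, Set.ncard_coe_finset, d.card_children_out]
  label := fun e => d.lab (d.isForest.edgeEquiv.symm e)

theorem labels_toTree_eq_map_filter (v : Fin n) : d.toTree.labels v =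
    (Finset.univ.filter fun u => u ≠ d.out ∧ (v = u ∨ v = d.parent u)).val.map d.lab := by
  let e : {u // u ≠ d.out ∧ (v = u ∨ v = d.parent u)} ≃ d.toTree.IncidentEdge v :=
    (Equiv.subtypeSubtypeEquivSubtypeInter _ _).symm.trans
      (d.isForest.edgeEquiv.subtypeEquiv fun _ => Sym2.mem_iff.symm)
  have he : ∀ u, d.toTree.label (e u) = d.lab u := fun u =>
    congrArg (fun x => d.lab (Subtype.val x)) (d.isForest.edgeEquiv.symm_apply_apply _)
  rw [← Finset.univ_val_map_subtype_val, d.toTree.labels_eq_map_of_equiv v e, Multiset.map_map]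
  exact Multiset.map_congr rfl fun u _ => he u

/-- An edge label is stored at the child end, so `d.lab v` belongs to the edge from v to its parent.
-/
theorem labels_toTree_of_ne {v : Fin n} (hv : v ≠ d.out) :
    d.toTree.labels v = d.lab v ::ₘ d.childLabels v := by
  have h1 : (Finset.univ.filter fun u => u ≠ d.out ∧ (v = u ∨ v = d.parent u)) =
      insert v (children (Finset.univ.erase d.out) d.parent v) := by
    ext u
    simp only [Finset.mem_filter, Finset.mem_univ, true_and, Finset.mem_insert, mem_children,
      Finset.mem_erase, and_true, eq_comm (a := v)]
    constructor
    · tauto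
    · rintro (rfl | h) <;> tauto
  have h2 : v ∉ children (Finset.univ.erase d.out) d.parent v := fun h =>
    d.isForest.map_ne hv (mem_children.1 h).2
  rw [labels_toTree_eq_map_filter, h1, Finset.insert_val_of_notMem h2, Multiset.map_cons]
  rfl

theorem labels_toTree_out : d.toTree.labels d.out = d.childLabels d.out := by
  have h1 : (Finset.univ.filter fun u => u ≠ d.out ∧ (d.out = u ∨ d.out = d.parent u)) =
      children (Finset.univ.erase d.out) d.parent d.out := by
    ext u
    simp only [Finset.mem_filter, Finset.mem_univ, true_and, mem_children_out,
      eq_comm (a := d.out)]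
    tauto
  rw [labels_toTree_eq_map_filter, h1]
  rfl

theorem toTree_injective : Function.Injective (toTree : ParentData j n → LabeledTree k) := by
  intro d d' h
  have hG : parentGraph d.parent = parentGraph d'.parent := by
    have := (LabeledTree.mk.inj h).2.1
    exact eq_of_heq this
  have hout : d.out = d'.out := eq_of_heq (LabeledTree.mk.inj h).2.2.1
  have hlab := (LabeledTree.mk.inj h).2.2.2
  obtain ⟨o, f, l, hf, hl, hc⟩ := d
  obtain ⟨o', f', l', hf', hl', hc'⟩ := d'
  dsimp only at hG hout hlab
  subst hout
  obtain rfl := hf.eq_of_parentGraph_eq hf' hG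
  have hlab' := eq_of_heq hlab
  have : l = l' := by
    funext v
    by_cases hv : v = o
    · rw [hv, hl, hl']
    · have := congrFun hlab' (hf.edgeEquiv ⟨v, hv⟩)
      simpa using this
  subst this
  rfl

/-- The label stored at the root belongs to no edge; `j` is a dummy there and puts no condition on
`T`. -/
theorem exists_toTree_eq (j : Fin k) (T : LabeledTree k) :
    ∃ d : ParentData j T.n, d.toTree = T := by
  obtain ⟨n, G, hG, o, ho, L⟩ := T
  obtain ⟨f, hf, rfl⟩ := exists_isForest_of_isTree hG o
  let l : Fin n → Fin k := fun v => if h : v ≠ o then L (hf.edgeEquiv ⟨v, h⟩) else j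
  have hc : (children (Finset.univ.erase o) f o).card = 1 := by
    rw [← ho, ← Set.ncard_coe_finset]
    congr 1
    ext v
    rw [SimpleGraph.mem_neighborSet, parentGraph_adj, hf.map_root, Finset.mem_coe, mem_children]
    simp only [Finset.mem_erase, Finset.mem_univ, and_true]
    tauto
  refine ⟨⟨o, f, l, hf, by simp [l], hc⟩, ?_⟩
  unfold toTree
  congr 1
  funext e
  obtain ⟨v, rfl⟩ := hf.edgeEquiv.surjective e
  simp [l, v.2]

/-- Labeled trees are the same as parent functions with labels. -/
noncomputable def equivTree (j : Fin k) : (Σ n, ParentData j n) ≃ LabeledTree k :=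
  Equiv.ofBijective (fun d => d.2.toTree)
    ⟨by
      rintro ⟨n, d⟩ ⟨n', d'⟩ h
      obtain rfl : n = n' := congrArg LabeledTree.n h
      exact congrArg (Sigma.mk n) (toTree_injective h),
    fun T => by
      obtain ⟨d, hd⟩ := exists_toTree_eq j T
      exact ⟨⟨T.n, d⟩, hd⟩⟩

instance (j : Fin k) (n : ℕ) : Finite (ParentData j n) :=
  Finite.of_injective (fun d : ParentData j n => (d.out, d.parent, d.lab)) fun d d' h => by
    obtain ⟨o, f, l, hf, hl, hc⟩ := d
    obtain ⟨o', f', l', hf', hl', hc'⟩ := d'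
    simp only [Prod.mk.injEq] at h
    obtain ⟨rfl, rfl, rfl⟩ := h
    rfl

end ParentData

theorem labels_ne_zero (T : LabeledTree k) (v : Fin T.n) : T.labels v ≠ 0 := by
  have hj : Nonempty (Fin k) := by
    obtain ⟨i, -⟩ := Multiset.card_eq_one.1 T.card_labels_out
    exact ⟨i⟩
  obtain ⟨⟨n, d⟩, rfl⟩ := (ParentData.equivTree hj.some).surjective T
  change d.toTree.labels v ≠ 0
  by_cases hv : v = d.out
  · subst hv
    intro h
    have h1 := d.toTree.card_labels_out
    change (d.toTree.labels d.out).card = 1 at h1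
    rw [h] at h1
    simp at h1
  · rw [d.labels_toTree_of_ne hv]
    exact Multiset.cons_ne_zero

theorem finite_setOf_n_le (k N : ℕ) : {T : LabeledTree k | T.n ≤ N}.Finite := by
  rcases isEmpty_or_nonempty (Fin k) with hk | ⟨⟨j⟩⟩
  · have : IsEmpty (LabeledTree k) := ⟨fun T => by
      obtain ⟨i, -⟩ := Multiset.card_eq_one.1 T.card_labels_out
      exact hk.elim i⟩
    exact Set.toFinite _
  · refine Set.Finite.subset (Set.finite_range fun d : Σ n : Fin (N + 1), ParentData j n =>
      d.2.toTree) fun T hT => ?_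
    obtain ⟨d, hd⟩ := ParentData.exists_toTree_eq j T
    exact ⟨⟨⟨T.n, Nat.lt_succ_of_le hT⟩, d⟩, hd⟩

end LabeledTree

/-! ### Weighted sums over labeled trees and amplitudes -/

namespace LabeledTree

open ParentForest

variable {k : ℕ}

namespace ParentData

/-- The product of the vertex weights of a tree given by a parent function. -/
noncomputable def weight (c : Fin k → Multiset (Fin k) → ℝ) {j : Fin k} {n : ℕ}
    (d : ParentData j n) : ℝ :=
  (if d.childLabels d.out = {j} then 1 else 0) *
    ∏ v ∈ Finset.univ.erase d.out, c (d.lab v) (d.childLabels v)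

/-- The vertex weights, with the root `o` required to have exactly one child, labeled by `j`. -/
noncomputable def rootedWeight {n : ℕ} (c : Fin k → Multiset (Fin k) → ℝ) (j : Fin k) (o v : Fin n)
    (a : Fin k) (s : Multiset (Fin k)) : ℝ :=
  if v = o then (if s = {j} then 1 else 0) else c a s

/-- Only singleton child sets with label `j` survive at `o`. Such a child can be chosen in n - 1
ways and is the root of a tree on the remaining vertices, counted by `P j`; the edge at `o` gives
the extra X. -/
theorem labeledForestSum_rootedWeight {c : Fin k → Multiset (Fin k) → ℝ}
    {P : Fin k → PowerSeries ℝ} (hP : SolvesTreeEquation c P) (j : Fin k) {n : ℕ} (o : Fin n) :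
    labeledForestSum (rootedWeight c j o) (Finset.univ.erase o) {o} (fun _ => j) =
      (n - 1).factorial * PowerSeries.coeff (n - 1) (PowerSeries.X * P j) := by
  classical
  have hA : (Finset.univ.erase o).card = n - 1 := by simp
  set A := Finset.univ.erase o with hAdef
  refine (labeledForestSum_step (rootedWeight c j o) (by simp [hAdef])
    (Finset.mem_singleton_self o) _).trans ((Finset.sum_congr rfl fun C hC => ?_).trans
    ((Finset.sum_powerset_apply_card (fun m => ∑ i : Fin m → Fin k,
      (if Finset.univ.val.map i = {j} then 1 else 0) *
        (((A.card - m).factorial : ℝ) * PowerSeries.coeff (A.card - m)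
          ((Finset.univ.val.map i).map P).prod))).trans ?_))
  · rw [Finset.mem_powerset] at hC
    rw [← sum_labelings_eq C (fun _ => j) fun s => (if s = {j} then 1 else 0) *
        (((A.card - C.card).factorial : ℝ) * PowerSeries.coeff (A.card - C.card) (s.map P).prod)]
    refine Finset.sum_congr rfl fun l _ => ?_
    rw [labeledForestSum_eq hP (c' := rootedWeight c j o), Finset.card_sdiff_of_subset hC,
      Multiset.map_map]
    · simp [rootedWeight]
    · simpa using Finset.sdiff_disjoint
    · intro v hv
      have hvo : v ≠ o := by
        rw [Finset.erase_singleton, Finset.empty_union, Finset.sdiff_union_of_subset hC] at hv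
        exact Finset.ne_of_mem_erase hv
      funext a s
      simp [rootedWeight, hvo]
  rw [Finset.sum_eq_single 1]
  · rw [← (Equiv.funUnique (Fin 1) (Fin k)).symm.sum_comp, hA]
    simp only [Nat.choose_one_right, Finset.univ_unique, Finset.singleton_val,
      Multiset.map_singleton, Multiset.prod_singleton, Multiset.singleton_inj, nsmul_eq_mul]
    simp only [Equiv.funUnique_symm_apply, uniqueElim_const, ite_mul, one_mul, zero_mul,
      Finset.sum_ite_eq', Finset.mem_univ, if_true]
    rcases h : n - 1 with _ | m
    · simp
    · rw [PowerSeries.coeff_succ_X_mul, Nat.factorial_succ]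
      push_cast
      ring
  · intro m _ hm
    rw [Finset.sum_eq_zero, smul_zero]
    intro i _
    rw [if_neg, zero_mul]
    intro h
    have := congrArg Multiset.card h
    simp at this
    exact hm this
  · intro h
    have : A.card = 0 := by simpa using h
    simp [this]

/-- The n choices of the distinguished leaf complete (n - 1)! to n!. -/
theorem sum_weight {c : Fin k → Multiset (Fin k) → ℝ}
    {P : Fin k → PowerSeries ℝ} (hP : SolvesTreeEquation c P) (j : Fin k) (n : ℕ)
    [Fintype (ParentData j n)] :
    ∑ d : ParentData j n, d.weight c =
      n.factorial * PowerSeries.coeff (n - 1) (PowerSeries.X * P j) := by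
  classical
  have h1 : ∑ d : ParentData j n, d.weight c = ∑ o : Fin n,
      labeledForestSum (rootedWeight c j o) (Finset.univ.erase o) {o} (fun _ => j) := by
    unfold labeledForestSum forestSum
    simp_rw [Finset.sum_sigma']
    refine Finset.sum_of_injOn (fun d => ⟨d.out, d.lab, d.parent⟩) ?_ ?_ ?_ ?_
    · rintro ⟨o, f, l, hf, hl, hc⟩ - ⟨o', f', l', hf', hl', hc'⟩ - h
      cases h
      rfl
    · intro d _
      simp only [Finset.coe_sigma, Set.mem_sigma_iff, Finset.mem_coe, Finset.mem_univ,
        Finset.mem_filter, Finset.mem_erase, true_and, and_true, not_not, forall_eq]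
      exact ⟨d.lab_out, d.isForest⟩
    · rintro ⟨o, l, f⟩ hm h
      simp only [Finset.mem_sigma, Finset.mem_univ, Finset.mem_filter, Finset.mem_erase, true_and,
        and_true, not_not, forall_eq] at hm
      rw [Finset.prod_eq_zero (i := o) (by simp)]
      have : ((children (Finset.univ.erase o) f o).val.map l) ≠ {j} := by
        intro hch
        refine h ⟨⟨o, f, l, hm.2, hm.1, ?_⟩, by simp, rfl⟩
        simpa using congrArg Multiset.card hch
      simp [rootedWeight, this]
    · intro d _
      dsimp only
      rw [Finset.prod_union (by simp), Finset.prod_singleton, mul_comm, weight]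
      congr 1
      · simp only [rootedWeight, if_true]
        rfl
      · refine Finset.prod_congr rfl fun v hv => ?_
        simp only [rootedWeight, if_neg (Finset.ne_of_mem_erase hv)]
        rfl
  rw [h1]
  simp_rw [labeledForestSum_rootedWeight hP]
  rcases n with _ | n
  · simp
  · simp only [Finset.sum_const, Finset.card_univ, Fintype.card_fin, nsmul_eq_mul,
      Nat.add_sub_cancel, Nat.factorial_succ]
    push_cast
    ring

theorem abs_weight (c : Fin k → Multiset (Fin k) → ℝ) {j : Fin k} {n : ℕ}
    (d : ParentData j n) : |d.weight c| = d.weight fun a s => |c a s| := by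
  rw [weight, weight, abs_mul, Finset.abs_prod]
  congr 1
  split_ifs <;> simp

theorem hasSum_weight {c : Fin k → Multiset (Fin k) → ℝ} {P Q : Fin k → PowerSeries ℝ}
    (hP : SolvesTreeEquation c P) (hQ : SolvesTreeEquation (fun j s => |c j s|) Q)
    (hQs : ∀ j, Summable fun n => (Q j).coeff n) (j : Fin k) :
    HasSum (fun d : Σ n, ParentData j n => d.2.weight c / d.1.factorial)
      (∑' n, (P j).coeff n) := by
  classical
  have hfin : ∀ n, Fintype (ParentData j n) := fun n => Fintype.ofFinite _
  have hrow : ∀ {c : Fin k → Multiset (Fin k) → ℝ} {P : Fin k → PowerSeries ℝ},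
      SolvesTreeEquation c P → ∀ n, HasSum (fun d : ParentData j n => d.weight c / n.factorial)
        (PowerSeries.coeff (n - 1) (PowerSeries.X * P j)) := fun {c P} hP n => by
    have h1 := hasSum_fintype fun d : ParentData j n => d.weight c / n.factorial
    rw [← Finset.sum_div, sum_weight hP] at h1
    have : (n.factorial : ℝ) ≠ 0 := by positivity
    rwa [mul_div_cancel_left₀ _ this] at h1
  -- A tree with n vertices matches the coefficient of index n - 2, one vertex being the
  -- distinguished leaf and one its neighbor. The entries at n = 0 and n = 1 vanish because of the
  -- factor X.
  have hshift : ∀ (f : PowerSeries ℝ) (a : ℝ), HasSum (fun n => f.coeff n) a →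
      HasSum (fun n => PowerSeries.coeff (n - 1) (PowerSeries.X * f)) a := fun f a h => by
    rw [← hasSum_nat_add_iff' 2]
    simpa [Finset.sum_range_succ, PowerSeries.coeff_succ_X_mul] using h
  have hs : Summable fun d : Σ n, ParentData j n => d.2.weight c / d.1.factorial := by
    refine Summable.of_norm ?_
    have h1 : (fun d : Σ n, ParentData j n => ‖d.2.weight c / d.1.factorial‖) =
        fun d => (d.2.weight fun a s => |c a s|) / (d.1.factorial : ℝ) := by
      funext d
      rw [norm_div, Real.norm_eq_abs, abs_weight, Real.norm_natCast]
    rw [h1]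
    refine (summable_sigma_of_nonneg fun d => ?_).2
      ⟨fun n => (hrow hQ n).summable, ?_⟩
    · rw [← abs_weight]; positivity
    · simp_rw [fun n => (hrow hQ n).tsum_eq]
      exact (hshift _ _ (hQs j).hasSum).summable
  have hPs : Summable fun n => (P j).coeff n :=
    (hQs j).of_norm_bounded fun n => hP.abs_coeff_le hQ j n
  have h2 := hs.hasSum.sigma (hrow hP)
  rw [← h2.unique (hshift _ _ hPs.hasSum)]
  exact hs.hasSum

end ParentData

variable {S : Type*} [Fintype S] (K : KLConstraintProblem S k)

theorem coupling_eq (T : LabeledTree k) (v : Fin T.n) : T.coupling K v =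
    (-1) ^ ((T.labels v).card + 1) * K.multisetCumulant (T.labels v) := by
  rw [coupling, K.jointCumulant_eq, card_labels]
  rfl

theorem labels_eq_singleton_iff (T : LabeledTree k) (v : Fin T.n) (i : Fin k) :
    T.labels v = {i} ↔ T.valency v = 1 ∧ ∃ e : T.IncidentEdge v, T.label e = i := by
  have h : i ∈ T.labels v ↔ ∃ e : T.IncidentEdge v, T.label e = i := by
    simp [labels]
  rw [← card_labels, ← h]
  constructor
  · intro h
    simp [h]
  · rintro ⟨h1, h2⟩
    obtain ⟨i', h3⟩ := Multiset.card_eq_one.1 h1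
    rw [h3, Multiset.mem_singleton] at h2
    rw [h3, h2]

theorem leafIndex_eq (T : LabeledTree k) (i : Fin k) : T.leafIndex i =
    ((Finset.univ.erase T.out).filter fun v => T.labels v = {i}).card := by
  rw [leafIndex, ← Set.ncard_coe_finset]
  congr 1
  ext v
  simp [labels_eq_singleton_iff]

theorem isCumulantTree_iff (T : LabeledTree k) (j : Fin k) : T.IsCumulantTree j ↔
    (∀ v, (T.labels v).card ≠ 1 → 3 ≤ (T.labels v).card) ∧ T.labels T.out = {j} := by
  simp only [IsCumulantTree, card_labels]
  refine and_congr_right fun _ => ?_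
  obtain ⟨i, hi⟩ := Multiset.card_eq_one.1 T.card_labels_out
  have h : ∀ e : T.IncidentEdge T.out, T.label e = i := fun e => by
    have : T.label e ∈ T.labels T.out := Multiset.mem_map_of_mem _ (Finset.mem_univ_val e)
    rwa [hi, Multiset.mem_singleton] at this
  obtain ⟨-, e, -⟩ := (T.labels_eq_singleton_iff T.out i).1 hi
  rw [hi, Multiset.singleton_inj]
  exact ⟨fun h' => (h e).symm.trans (h' e), fun h' e => (h e).trans h'⟩

/-- The contribution of a cumulant tree to the power series of the exponential parameters, before
division by the order of the automorphism group. -/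
noncomputable def term (ρ : Fin k → ℝ) (j : Fin k) (T : LabeledTree k) : ℝ :=
  open Classical in
  if T.IsCumulantTree j then T.amplitude K * ∏ i, (-ρ i) ^ T.leafIndex i else 0

/-- The contribution of a vertex, as a function of the labels of the edges at it. -/
noncomputable def vertexFactor (ρ : Fin k → ℝ) (L : Multiset (Fin k)) : ℝ :=
  if L.card = 1 then (L.map fun i => -ρ i).prod
  else if L.card = 2 then 0 else (-1) ^ (L.card + 1) * K.multisetCumulant L

theorem vertexWeight_eq_vertexFactor (ρ : Fin k → ℝ) (a : Fin k) (s : Multiset (Fin k)) :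
    K.vertexWeight ρ a s = vertexFactor K ρ (a ::ₘ s) := by
  simp only [KLConstraintProblem.vertexWeight, vertexFactor, Multiset.card_cons]
  by_cases h0 : s.card = 0
  · rw [Multiset.card_eq_zero] at h0
    simp [h0]
  · rw [if_neg h0, if_neg (by omega : ¬ s.card + 1 = 1)]
    by_cases h1 : s.card = 1
    · rw [if_pos h1, if_pos (by omega : s.card + 1 = 2)]
    · rw [if_neg h1, if_neg (by omega : ¬ s.card + 1 = 2)]
      ring

theorem prod_leaves (ρ : Fin k → ℝ) (T : LabeledTree k) :
    ∏ v ∈ (Finset.univ.erase T.out).filter (fun v => (T.labels v).card = 1),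
      ((T.labels v).map fun i => -ρ i).prod = ∏ i, (-ρ i) ^ T.leafIndex i := by
  classical
  have hj : Nonempty (Fin k) := by
    obtain ⟨i, -⟩ := Multiset.card_eq_one.1 T.card_labels_out
    exact ⟨i⟩
  have h : ∀ v, (T.labels v).card = 1 → ∃ i, T.labels v = {i} := fun v h =>
    Multiset.card_eq_one.1 h
  choose! l hl using h
  rw [← Finset.prod_fiberwise _ l]
  refine Finset.prod_congr rfl fun i _ => ?_
  rw [leafIndex_eq, ← Finset.prod_const]
  refine Finset.prod_congr ?_ fun v hv => ?_
  · ext v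
    simp only [Finset.mem_filter, and_assoc]
    refine and_congr_right fun _ => ⟨fun h => by rw [hl v h.1, h.2], fun h => ?_⟩
    have h1 : (T.labels v).card = 1 := by rw [h]; simp
    refine ⟨h1, ?_⟩
    have := hl v h1
    rw [h, Multiset.singleton_inj] at this
    exact this.symm
  · simp [(Finset.mem_filter.1 hv).2]

/-- A bivalent vertex kills both sides. Otherwise every non-leaf has valency at least 3, and the
product splits into leaves, giving the monomial in -ρ, and inner vertices, giving the amplitude. -/
theorem term_eq (ρ : Fin k → ℝ) (j : Fin k) (T : LabeledTree k) : T.term K ρ j =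
    (if T.labels T.out = {j} then 1 else 0) *
      ∏ v ∈ Finset.univ.erase T.out, vertexFactor K ρ (T.labels v) := by
  classical
  by_cases hout : T.labels T.out = {j}
  swap
  · rw [if_neg hout, zero_mul, term, if_neg fun h => hout ((T.isCumulantTree_iff j).1 h).2]
  rw [if_pos hout, one_mul]
  by_cases h2 : ∃ v, (T.labels v).card = 2
  · obtain ⟨v, hv⟩ := h2
    have hvo : v ≠ T.out := fun e => by
      have := T.card_labels_out
      rw [e] at hv
      omega
    rw [Finset.prod_eq_zero (i := v) (by simp [hvo]), term, if_neg]
    · intro h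
      have := ((T.isCumulantTree_iff j).1 h).1 v
      omega
    · simp [vertexFactor, hv]
  · push Not at h2
    have hcum : T.IsCumulantTree j := by
      refine (T.isCumulantTree_iff j).2 ⟨fun v h1 => ?_, hout⟩
      have h0 : (T.labels v).card ≠ 0 := fun h => T.labels_ne_zero v (Multiset.card_eq_zero.1 h)
      have := h2 v
      omega
    rw [term, if_pos hcum, ← Finset.prod_filter_mul_prod_filter_not (Finset.univ.erase T.out)
      (fun v => (T.labels v).card = 1), mul_comm, ← T.prod_leaves ρ]
    congr 1
    · refine Finset.prod_congr rfl fun v hv => ?_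
      rw [vertexFactor, if_pos (Finset.mem_filter.1 hv).2]
    · rw [amplitude]
      refine Finset.prod_congr ?_ fun v hv => ?_
      · ext v
        simp only [Finset.mem_filter, Finset.mem_univ, true_and, Finset.mem_erase, card_labels,
          and_true]
        exact ⟨fun h => ⟨fun e => h (by rw [e]; exact T.out_leaf), h⟩, fun h => h.2⟩
      · have := (Finset.mem_filter.1 hv).2
        rw [coupling_eq, vertexFactor, if_neg this, if_neg (h2 v)]

theorem term_toTree (ρ : Fin k → ℝ) {j : Fin k} {n : ℕ} (d : ParentData j n) :
    d.toTree.term K ρ j = d.weight (K.vertexWeight ρ) := by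
  rw [term_eq, ParentData.weight]
  change (if d.toTree.labels d.out = {j} then (1 : ℝ) else 0) *
    ∏ v ∈ Finset.univ.erase d.out, vertexFactor K ρ (d.toTree.labels v) = _
  rw [d.labels_toTree_out]
  congr 1
  refine Finset.prod_congr rfl fun v hv => ?_
  rw [vertexWeight_eq_vertexFactor, d.labels_toTree_of_ne (Finset.ne_of_mem_erase hv)]

/-- The exponential parameters are sums over labeled trees. -/
theorem hasSum_term {ρ : Fin k → ℝ} {P Q : Fin k → PowerSeries ℝ}
    (hP : SolvesTreeEquation (K.vertexWeight ρ) P)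
    (hQ : SolvesTreeEquation (fun j s => |K.vertexWeight ρ j s|) Q)
    (hQs : ∀ j, Summable fun n => (Q j).coeff n) (j : Fin k) :
    HasSum (fun T : LabeledTree k => T.term K ρ j / T.n.factorial) (∑' n, (P j).coeff n) := by
  rw [← (ParentData.equivTree j).hasSum_iff]
  refine Eq.subst (motive := fun f : (Σ n, ParentData j n) → ℝ => HasSum f _) ?_
    (ParentData.hasSum_weight hP hQ hQs j)
  funext d
  rw [← term_toTree]
  rfl

theorem sum_leafIndex (T : LabeledTree k) : ∑ i, T.leafIndex i =
    ((Finset.univ.erase T.out).filter fun v => (T.labels v).card = 1).card := by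
  classical
  simp_rw [leafIndex_eq]
  rw [← Finset.card_biUnion]
  · congr 1
    ext v
    simp [Multiset.card_eq_one]
  · intro i _ i' _ hne
    refine Finset.disjoint_left.2 fun v hv hv' => hne ?_
    have h1 := (Finset.mem_filter.1 hv).2
    have h2 := (Finset.mem_filter.1 hv').2
    exact Multiset.singleton_inj.1 (h1.symm.trans h2)

/-- Valencies sum to 2(n - 1). With L leaves besides the distinguished one, adding 2 at each of the
L + 1 leaves brings every vertex to at least 3, so 2(n - 1) + 2(L + 1) ≥ 3n. -/
theorem n_le_of_isCumulantTree {T : LabeledTree k} {j : Fin k} (hT : T.IsCumulantTree j) :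
    T.n ≤ 2 * ∑ i, T.leafIndex i := by
  classical
  have h1 : ∀ v, T.graph.degree v = (T.labels v).card := fun v => by
    rw [card_labels, valency, ← SimpleGraph.card_neighborSet_eq_degree, Set.ncard_eq_toFinset_card',
      Set.toFinset_card]
  have h2 := T.graph.sum_degrees_eq_twice_card_edges
  have h3 := T.isTree.card_edgeFinset
  rw [Fintype.card_fin] at h3
  simp_rw [h1] at h2
  rw [sum_leafIndex]
  set A := (Finset.univ.erase T.out).filter fun v => (T.labels v).card = 1
  have h4 : ∀ v, (T.labels v).card + 2 * (if v ∈ insert T.out A then 1 else 0) ≥ 3 := fun v => by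
    have h5 := hT.1 v
    rw [← card_labels] at h5
    by_cases hv : (T.labels v).card = 1
    · rw [if_pos, hv]
      by_cases hvo : v = T.out
      · simp [hvo]
      · simp [A, hvo, hv]
    · have := h5 hv
      omega
  have h6 := Finset.sum_le_sum fun v (_ : v ∈ Finset.univ) => h4 v
  have h7 : T.out ∉ A := by simp [A]
  rw [Finset.sum_add_distrib, h2, ← Finset.mul_sum, Finset.sum_boole, Finset.filter_mem_eq_inter,
    Finset.univ_inter, Finset.card_insert_of_notMem h7] at h6
  simp at h6
  omega

end LabeledTree

/-! ### Isomorphism classes and automorphisms -/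

namespace LabeledTree

variable {k : ℕ}

namespace Iso

variable {T T' T'' : LabeledTree k}

theorem ext_toIso {φ ψ : Iso T T'} (h : ∀ v, φ.toIso v = ψ.toIso v) : φ = ψ := by
  obtain ⟨φ, h1, h2⟩ := φ
  obtain ⟨ψ, h3, h4⟩ := ψ
  obtain rfl : φ = ψ := RelIso.ext h
  rfl

/-- The composition of isomorphisms of labeled trees. -/
def trans (φ : Iso T T') (ψ : Iso T' T'') : Iso T T'' where
  toIso := φ.toIso.trans ψ.toIso
  map_out := by rw [← ψ.map_out, ← φ.map_out]; rfl
  map_label e := by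
    rw [← φ.map_label, ← ψ.map_label]
    congr 1
    ext1
    simp [SimpleGraph.Iso.mapEdgeSet, SimpleGraph.Hom.mapEdgeSet, Sym2.map_map]

/-- The inverse of an isomorphism of labeled trees. -/
def symm (φ : Iso T T') : Iso T' T where
  toIso := φ.toIso.symm
  map_out := by rw [← φ.map_out]; exact φ.toIso.symm_apply_apply _
  map_label e := by
    rw [← φ.map_label]
    congr 1
    exact φ.toIso.mapEdgeSet.apply_symm_apply e

theorem n_eq (φ : Iso T T') : T.n = T'.n := by
  simpa using Fintype.card_congr φ.toIso.toEquiv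

/-- Amplitude, leaf index and the cumulant tree condition depend only on these multisets and the
distinguished leaf, so their invariance follows from this. -/
theorem labels_map (φ : Iso T T') (v : Fin T.n) : T'.labels (φ.toIso v) = T.labels v := by
  let e : T.IncidentEdge v ≃ T'.IncidentEdge (φ.toIso v) :=
    φ.toIso.mapEdgeSet.subtypeEquiv fun e => by
      change v ∈ (e : Sym2 _) ↔ φ.toIso v ∈ Sym2.map φ.toIso (e : Sym2 _)
      rw [Sym2.mem_map]
      constructor
      · exact fun h => ⟨v, h, rfl⟩
      · rintro ⟨w, hw, h⟩
        rwa [← φ.toIso.injective h]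
  rw [T'.labels_eq_map_of_equiv _ e]
  exact Multiset.map_congr rfl fun a _ => φ.map_label a

theorem isCumulantTree_iff (φ : Iso T T') (j : Fin k) :
    T'.IsCumulantTree j ↔ T.IsCumulantTree j := by
  rw [LabeledTree.isCumulantTree_iff, LabeledTree.isCumulantTree_iff, ← φ.map_out,
    φ.labels_map, ← φ.toIso.toEquiv.forall_congr_right]
  simp only [RelIso.coe_fn_toEquiv, φ.labels_map]

theorem leafIndex_eq (φ : Iso T T') : T'.leafIndex = T.leafIndex := by
  funext i
  rw [LabeledTree.leafIndex_eq, LabeledTree.leafIndex_eq]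
  refine (Finset.card_equiv φ.toIso.toEquiv fun v => ?_).symm
  simp only [Finset.mem_filter, Finset.mem_erase, Finset.mem_univ, and_true,
    RelIso.coe_fn_toEquiv, φ.labels_map, ← φ.map_out, ne_eq, φ.toIso.injective.eq_iff]

theorem amplitude_eq {S : Type*} [Fintype S] (K : KLConstraintProblem S k) (φ : Iso T T') :
    T'.amplitude K = T.amplitude K := by
  classical
  unfold amplitude
  refine (Finset.prod_equiv φ.toIso.toEquiv (fun v => ?_) fun v _ => ?_).symm
  · simp only [Finset.mem_filter, Finset.mem_univ, true_and, RelIso.coe_fn_toEquiv,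
      ← card_labels, φ.labels_map]
  · rw [coupling_eq, coupling_eq, RelIso.coe_fn_toEquiv, φ.labels_map]

end Iso

/-- The labeled tree obtained by renaming the vertices. -/
def rename (T : LabeledTree k) (σ : Equiv.Perm (Fin T.n)) : LabeledTree k where
  n := T.n
  graph := T.graph.comap σ.symm
  isTree := (SimpleGraph.Iso.comap σ.symm T.graph).isTree_iff.2 T.isTree
  out := σ T.out
  out_leaf := by
    have h := T.out_leaf
    rw [← Nat.card_coe_set_eq] at h ⊢
    rw [← h, Nat.card_congr ((SimpleGraph.Iso.comap σ.symm T.graph).mapNeighborSet (σ T.out))]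
    simp
  label e := T.label ((SimpleGraph.Iso.comap σ.symm T.graph).mapEdgeSet e)

/-- The isomorphism from a labeled tree to the one with renamed vertices. -/
def renameIso (T : LabeledTree k) (σ : Equiv.Perm (Fin T.n)) : Iso T (T.rename σ) where
  toIso := (SimpleGraph.Iso.comap σ.symm T.graph).symm
  map_out := rfl
  map_label e := congrArg T.label
    ((SimpleGraph.Iso.comap σ.symm T.graph).mapEdgeSet.apply_symm_apply e)

/-- Renamings of the vertices correspond to isomorphisms to arbitrary labeled trees. -/
theorem rename_bijective (T : LabeledTree k) : Function.Bijective
    (fun σ : Equiv.Perm (Fin T.n) => (⟨T.rename σ, T.renameIso σ⟩ : Σ T', Iso T T')) := by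
  constructor
  · intro σ τ h
    have h1 := congrArg (fun x : (Σ T', Iso T T') => fun v => ((x.2.toIso v : Fin x.1.n) : ℕ)) h
    ext v
    exact congrFun h1 v
  · rintro ⟨⟨n', G', hG', o', ho', L'⟩, φ⟩
    obtain ⟨n, G, hG, o, ho, L⟩ := T
    obtain rfl : n = n' := φ.n_eq
    obtain ⟨⟨σ, hσ⟩, h1, h2⟩ := φ
    dsimp only at σ hσ h1 h2
    have hG : G.comap σ.symm = G' := by
      ext u v
      exact (RelIso.mk σ hσ).symm.map_rel_iff
    subst hG
    obtain rfl : o' = σ o := h1.symm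
    refine ⟨σ, ?_⟩
    have hL : L' = fun e => L ((SimpleGraph.Iso.comap σ.symm G).mapEdgeSet e) := by
      funext e
      rw [← h2]
      congr 1
      exact (SimpleGraph.Iso.mapEdgeSet (RelIso.mk σ hσ)).apply_symm_apply e |>.symm
    subst hL
    rfl

/-- Orbit counting: the pairs of a tree T' and an isomorphism from `T` to it correspond to the n!
renamings of `T`, and over each T' in the class the isomorphisms form a torsor under `Aut T`. -/
theorem card_class_mul_card_aut (T : LabeledTree k) :
    Nat.card {T' : LabeledTree k // Nonempty (Iso T T')} * Nat.card (Aut T) =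
      T.n.factorial := by
  have h1 : Nat.card (Σ T', Iso T T') = T.n.factorial := by
    rw [← Nat.card_congr (Equiv.ofBijective _ T.rename_bijective), Nat.card_eq_fintype_card,
      Fintype.card_perm, Fintype.card_fin]
  rw [← h1, ← Nat.card_prod]
  refine Nat.card_congr (Equiv.ofBijective
    (fun p : {T' : LabeledTree k // Nonempty (Iso T T')} × Aut T =>
      (⟨p.1.1, p.2.trans p.1.2.some⟩ : Σ T', Iso T T')) ⟨?_, ?_⟩)
  · rintro ⟨⟨T₁, h₁⟩, α⟩ ⟨⟨T₂, h₂⟩, β⟩ h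
    obtain rfl : T₁ = T₂ := congrArg Sigma.fst h
    have h3 := eq_of_heq (Sigma.mk.inj h).2
    have : α = β := Iso.ext_toIso fun v => by
      have h4 := congrArg (fun φ : Iso T T₁ => φ.toIso v) h3
      exact h₁.some.toIso.injective h4
    rw [this]
  · rintro ⟨T', φ⟩
    refine ⟨⟨⟨T', ⟨φ⟩⟩, φ.trans (Nonempty.intro φ : Nonempty (Iso T T')).some.symm⟩, ?_⟩
    refine congrArg (Sigma.mk T') (Iso.ext_toIso fun v => ?_)
    exact RelIso.apply_symm_apply _ _

theorem finite_setOf_isCumulantTree (j : Fin k) (I : Fin k → ℕ) :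
    {T : LabeledTree k | T.IsCumulantTree j ∧ T.leafIndex = I}.Finite := by
  refine (finite_setOf_n_le k (2 * ∑ i, I i)).subset ?_
  rintro T ⟨h1, rfl⟩
  exact n_le_of_isCumulantTree h1

theorem mk_mem_cumulantTreeTypes_iff (j : Fin k) (I : Fin k → ℕ) (T : LabeledTree k) :
    (Quotient.mk _ T : Quotient (isoSetoid k)) ∈ cumulantTreeTypes j I ↔
      T.IsCumulantTree j ∧ T.leafIndex = I := by
  constructor
  · rintro ⟨T', h1, h2, h3⟩
    obtain ⟨φ⟩ := Quotient.exact h3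
    exact ⟨(φ.isCumulantTree_iff j).2 h1, φ.leafIndex_eq.trans h2⟩
  · exact fun h => ⟨T, h.1, h.2, rfl⟩

end LabeledTree

open LabeledTree

theorem cumulantTreeTypes_finite {k : ℕ} (j : Fin k) (I : Fin k → ℕ) :
    (cumulantTreeTypes j I).Finite := by
  refine ((finite_setOf_isCumulantTree j I).image (Quotient.mk (isoSetoid k))).subset ?_
  rintro c ⟨T, h1, h2, rfl⟩
  exact ⟨T, ⟨h1, h2⟩, rfl⟩

/-- The amplitude is constant on a class, and a class has n!/|Aut| members, so 1/n! per tree becomes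
1/|Aut| per class. -/
theorem finsum_cumulantTreeTypes {S : Type*} [Fintype S] {k : ℕ} (K : KLConstraintProblem S k)
    (j : Fin k) (I : Fin k → ℕ) :
    ∑ᶠ c ∈ cumulantTreeTypes j I, amplitude K c.out / (Nat.card (Aut c.out) : ℝ) =
      ∑ T ∈ (finite_setOf_isCumulantTree j I).toFinset, T.amplitude K / T.n.factorial := by
  classical
  rw [finsum_mem_eq_finite_toFinset_sum _ (cumulantTreeTypes_finite j I),
    ← Finset.sum_fiberwise_of_maps_to (g := fun T => (Quotient.mk (isoSetoid k) T))
      (t := (cumulantTreeTypes_finite j I).toFinset)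
      (fun T hT => by
        rw [Set.Finite.mem_toFinset] at hT ⊢
        exact (mk_mem_cumulantTreeTypes_iff j I T).2 hT)]
  refine Finset.sum_congr rfl fun c hc => ?_
  rw [Set.Finite.mem_toFinset] at hc
  have hout : c.out.IsCumulantTree j ∧ c.out.leafIndex = I := by
    rw [← mk_mem_cumulantTreeTypes_iff, Quotient.out_eq]
    exact hc
  have hmem : ∀ T, T ∈ (finite_setOf_isCumulantTree j I).toFinset.filter
      (fun T => Quotient.mk (isoSetoid k) T = c) ↔ Nonempty (Iso c.out T) := fun T => by
    rw [Finset.mem_filter, Set.Finite.mem_toFinset]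
    constructor
    · rintro ⟨-, rfl⟩
      exact Quotient.mk_out T
    · rintro ⟨φ⟩
      refine ⟨⟨(φ.isCumulantTree_iff j).2 hout.1, φ.leafIndex_eq.trans hout.2⟩, ?_⟩
      rw [← Quotient.out_eq c]
      exact Quotient.sound ⟨φ.symm⟩
  have hconst : ∀ T ∈ (finite_setOf_isCumulantTree j I).toFinset.filter
      (fun T => Quotient.mk (isoSetoid k) T = c),
      T.amplitude K / T.n.factorial = c.out.amplitude K / c.out.n.factorial := fun T hT => by
    obtain ⟨φ⟩ := (hmem T).1 hT
    rw [φ.amplitude_eq K, φ.n_eq]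
  have hcard : ((finite_setOf_isCumulantTree j I).toFinset.filter
      (fun T => Quotient.mk (isoSetoid k) T = c)).card * Nat.card (Aut c.out) =
      c.out.n.factorial := by
    rw [← c.out.card_class_mul_card_aut]
    congr 1
    exact (Nat.subtype_card _ hmem).symm
  have h0 : (c.out.n.factorial : ℝ) ≠ 0 := by positivity
  have h1 : (Nat.card (Aut c.out) : ℝ) ≠ 0 := fun h => h0 (by
    rw [← hcard, Nat.cast_mul, h, mul_zero])
  rw [Finset.sum_congr rfl hconst, Finset.sum_const, nsmul_eq_mul, ← hcard, Nat.cast_mul]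
  rw [← hcard, Nat.cast_mul] at h0
  have h2 := left_ne_zero_of_mul h0
  field_simp

/-! ### Uniqueness of multivariate power series coefficients -/

theorem hasSum_sum_eq {k : ℕ} (f : (Fin k → ℕ) → ℝ) (n : ℕ) :
    HasSum (fun I : {I : Fin k → ℕ // ∑ i, I i = n} => f I)
      (∑ I ∈ Finset.univ.piAntidiag n, f I) := by
  have hs : {I : Fin k → ℕ | ∑ i, I i = n} = (Finset.univ.piAntidiag n : Finset (Fin k → ℕ)) := by
    ext I
    simp
  change HasSum (f ∘ ((↑) : {I : Fin k → ℕ | ∑ i, I i = n} → Fin k → ℕ)) _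
  rw [hs]
  exact Finset.hasSum _ f

theorem eq_zero_of_eventually_hasSum_pow_zero {a : ℕ → ℝ}
    (h : ∀ᶠ t in 𝓝 (0 : ℝ), HasSum (fun n => t ^ n * a n) 0) (n : ℕ) : a n = 0 := by
  have h1 : HasFPowerSeriesAt (0 : ℝ → ℝ) (FormalMultilinearSeries.ofScalars ℝ a) 0 := by
    rw [hasFPowerSeriesAt_iff]
    filter_upwards [h] with t ht
    simpa [FormalMultilinearSeries.coeff_ofScalars] using ht
  have h2 := congrArg (fun q => FormalMultilinearSeries.coeff q n) h1.eq_zero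
  exact FormalMultilinearSeries.coeff_ofScalars.symm.trans h2

/-- The coefficients of a convergent multivariate power series are determined by its sum. -/
theorem eq_zero_of_eventually_hasSum_zero {k : ℕ} {M : (Fin k → ℕ) → ℝ}
    (h : ∀ᶠ ρ in 𝓝 (0 : Fin k → ℝ), HasSum (fun I : Fin k → ℕ => M I * ∏ i, ρ i ^ I i) 0) :
    M = 0 := by
  classical
  obtain ⟨δ, hδ, hM⟩ := Metric.eventually_nhds_iff_ball.1 h
  let p : ℕ → MvPolynomial (Fin k) ℝ := fun n => ∑ I ∈ Finset.univ.piAntidiag n,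
    MvPolynomial.monomial (Finsupp.equivFunOnFinite.symm I) (M I)
  have hp : ∀ n ρ, MvPolynomial.eval ρ (p n) =
      ∑ I ∈ Finset.univ.piAntidiag n, M I * ∏ i, ρ i ^ I i := fun n ρ => by
    simp only [p, map_sum, MvPolynomial.eval_monomial]
    refine Finset.sum_congr rfl fun I _ => ?_
    rw [Finsupp.prod_fintype _ _ fun i => pow_zero _]
    rfl
  have hhom : ∀ n (t : ℝ) ρ, MvPolynomial.eval (t • ρ) (p n) =
      t ^ n * MvPolynomial.eval ρ (p n) := fun n t ρ => by
    rw [hp, hp, Finset.mul_sum]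
    refine Finset.sum_congr rfl fun I hI => ?_
    have : ∑ i, I i = n := (Finset.mem_piAntidiag.1 hI).1
    simp only [Pi.smul_apply, smul_eq_mul, mul_pow, Finset.prod_mul_distrib]
    rw [Finset.prod_pow_eq_pow_sum, this]
    ring
  -- Along the ray t ↦ tρ the series, grouped by degree, is a power series in t whose coefficients
  -- are the homogeneous parts at ρ; uniqueness in one variable applies.
  have hsmall : ∀ ρ ∈ Metric.ball (0 : Fin k → ℝ) δ, ∀ n, MvPolynomial.eval ρ (p n) = 0 := by
    intro ρ hρ
    refine eq_zero_of_eventually_hasSum_pow_zero ?_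
    filter_upwards [Metric.ball_mem_nhds (0 : ℝ) one_pos] with t ht
    rw [mem_ball_zero_iff] at ht hρ
    have h2 : t • ρ ∈ Metric.ball (0 : Fin k → ℝ) δ := by
      rw [mem_ball_zero_iff, norm_smul]
      exact (mul_le_of_le_one_left (norm_nonneg _) ht.le).trans_lt hρ
    have h3 := (Equiv.sigmaFiberEquiv fun I : Fin k → ℕ => ∑ i, I i).hasSum_iff.2 (hM _ h2)
    have h4 := h3.sigma fun n => hasSum_sum_eq (fun I => M I * ∏ i, (t • ρ) i ^ I i) n
    simp_rw [← hp, hhom] at h4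
    exact h4
  -- Homogeneity spreads the vanishing from the ball to all of space by scaling.
  have hzero : ∀ n, p n = 0 := fun n => by
    refine MvPolynomial.funext fun ρ => ?_
    rw [map_zero]
    have hpos : 0 < δ / (‖ρ‖ + 1) := by positivity
    have h1 := hsmall ((δ / (‖ρ‖ + 1)) • ρ) (by
      rw [mem_ball_zero_iff, norm_smul, Real.norm_of_nonneg hpos.le, div_mul_eq_mul_div,
        div_lt_iff₀ (by positivity)]
      exact mul_lt_mul_of_pos_left (lt_add_one _) hδ) n
    rw [hhom] at h1
    exact (mul_eq_zero.1 h1).resolve_left (pow_pos hpos n).ne'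
  funext I
  have h1 := congrArg (MvPolynomial.coeff (Finsupp.equivFunOnFinite.symm I)) (hzero (∑ i, I i))
  simp only [p, MvPolynomial.coeff_sum, MvPolynomial.coeff_monomial, MvPolynomial.coeff_zero,
    EmbeddingLike.apply_eq_iff_eq] at h1
  rw [Finset.sum_ite_eq', if_pos (by simp)] at h1
  exact h1

/-! ### The expansion of the exponential parameters -/

/-- The sum over all isomorphism types of cumulant trees. -/
noncomputable def treeCoeff {S : Type*} [Fintype S] {k : ℕ} (K : KLConstraintProblem S k)
    (j : Fin k) (I : Fin k → ℕ) : ℝ :=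
  (-1) ^ (∑ i, I i) * ∑ᶠ c ∈ cumulantTreeTypes j I,
    amplitude K c.out / (Nat.card (Aut c.out) : ℝ)

/-- The sum over trees is regrouped by leaf index, each group having only finitely many nonzero
terms. The sign (-1)^|I| comes from the leaf weights -ρ_i. -/
theorem hasSum_treeCoeff {S : Type*} [Fintype S] {k : ℕ} (K : KLConstraintProblem S k)
    {ρ : Fin k → ℝ} {j : Fin k} {a : ℝ}
    (h : HasSum (fun T : LabeledTree k => T.term K ρ j / T.n.factorial) a) :
    HasSum (fun I : Fin k → ℕ => treeCoeff K j I * ∏ i, ρ i ^ I i) a := by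
  classical
  refine ((Equiv.sigmaFiberEquiv (leafIndex : LabeledTree k → Fin k → ℕ)).hasSum_iff.2 h).sigma
    fun I => ?_
  have hsum : ∑ T ∈ (finite_setOf_isCumulantTree j I).toFinset,
      T.term K ρ j / T.n.factorial = treeCoeff K j I * ∏ i, ρ i ^ I i := by
    rw [treeCoeff, finsum_cumulantTreeTypes, mul_right_comm, Finset.mul_sum]
    refine Finset.sum_congr rfl fun T hT => ?_
    obtain ⟨h1, rfl⟩ := (Set.Finite.mem_toFinset _).1 hT
    have h2 : ∏ i, (-ρ i) ^ T.leafIndex i =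
        (-1) ^ (∑ i, T.leafIndex i) * ∏ i, ρ i ^ T.leafIndex i := by
      rw [← Finset.prod_pow_eq_pow_sum, ← Finset.prod_mul_distrib]
      exact Finset.prod_congr rfl fun i _ => by rw [neg_pow]
    rw [term, if_pos h1, h2]
    ring
  rw [← hsum]
  change HasSum ((fun T : LabeledTree k => T.term K ρ j / T.n.factorial) ∘
    ((↑) : {T : LabeledTree k | T.leafIndex = I} → LabeledTree k)) _
  rw [hasSum_subtype_iff_indicator]
  have h3 := hasSum_sum_of_ne_finset_zero (L := SummationFilter.unconditional _)
    (s := (finite_setOf_isCumulantTree j I).toFinset)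
    (f := {T : LabeledTree k | T.leafIndex = I}.indicator
      fun T : LabeledTree k => T.term K ρ j / T.n.factorial) (by
    intro T hT
    rw [Set.Finite.mem_toFinset] at hT
    refine Set.indicator_apply_eq_zero.2 fun hI => ?_
    rw [term, if_neg fun h => hT ⟨h, hI⟩, zero_div])
  convert h3 using 1
  refine Finset.sum_congr rfl fun T hT => ?_
  rw [Set.indicator_of_mem]
  exact ((Set.Finite.mem_toFinset _).1 hT).2

theorem isPerturbedExpansion_treeCoeff {S : Type*} [Fintype S] {k : ℕ}
    (K : KLConstraintProblem S k) (hK : K.Normalized) :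
    K.IsPerturbedExpansion (treeCoeff K) := by
  obtain ⟨δ, hδ, h⟩ := K.exists_expParam_eq_tsum hK
  filter_upwards [Metric.ball_mem_nhds (0 : Fin k → ℝ) hδ] with ρ hρ j
  obtain ⟨P, Q, hP, hQ, hQs, hmean⟩ := h ρ (mem_ball_zero_iff.1 hρ)
  rw [K.expParam_eq hK hmean, neg_neg]
  exact hasSum_treeCoeff K (hasSum_term K hP hQ hQs j)

theorem mainTheorem2 {S : Type*} [Fintype S] {k : ℕ} (K : KLConstraintProblem S k)
    (hK : K.Normalized) :
    -- near the origin the minimizer and its exponential parameters exist and are unique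
    (∀ᶠ ρ in 𝓝 (0 : Fin k → ℝ),
      (∃! P, K.IsMinimizer ρ P) ∧ ∃! lam, K.IsExponentialParameters ρ lam) ∧
    -- the exponential parameters have a convergent power series expansion
    (∃ L, K.IsPerturbedExpansion L) ∧
    -- the sums over trees are finite
    (∀ (j : Fin k) (I : Fin k → ℕ), (cumulantTreeTypes j I).Finite) ∧
    -- the coefficients are given by the sum over isomorphism types of cumulant trees
    ∀ L, K.IsPerturbedExpansion L → ∀ (j : Fin k) (I : Fin k → ℕ),
      L j I = (-1) ^ (∑ i, I i) *
        ∑ᶠ c ∈ cumulantTreeTypes j I,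
          LabeledTree.amplitude K c.out / (Nat.card (LabeledTree.Aut c.out) : ℝ) := by
  refine ⟨?_, ⟨_, isPerturbedExpansion_treeCoeff K hK⟩, cumulantTreeTypes_finite,
    fun L hL j I => ?_⟩
  · obtain ⟨δ, hδ, h⟩ := K.exists_expParam_eq_tsum hK
    filter_upwards [Metric.ball_mem_nhds (0 : Fin k → ℝ) hδ] with ρ hρ
    obtain ⟨P, Q, -, -, -, hmean⟩ := h ρ (mem_ball_zero_iff.1 hρ)
    exact ⟨⟨_, (K.isMinimizer_iff hmean _).2 rfl, fun _ => (K.isMinimizer_iff hmean _).1⟩,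
      ⟨_, (K.isExponentialParameters_iff hK hmean _).2 rfl,
        fun _ => (K.isExponentialParameters_iff hK hmean _).1⟩⟩
  · have h0 : (fun I => L j I - treeCoeff K j I) = 0 := by
      refine eq_zero_of_eventually_hasSum_zero ?_
      filter_upwards [hL, isPerturbedExpansion_treeCoeff K hK] with ρ h1 h2
      have h3 := (h1 j).sub (h2 j)
      simpa [sub_mul] using h3
    exact sub_eq_zero.1 (congrFun h0 I)
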